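/- Let $P(\mathbb{R}^3)$ be the set of Borel probability measures on $\mathbb{R}^3$ and let $$H^{-1}(\mathbb{R}^3)=\Big\{f\in\mathcal{S}'(\mathbb{R}^3):\ \int_{\mathbb{R}^3}\frac{|\widehat f(k)|^2}{1+|k|^2}\,dk<\infty\Big\},$$ where probability measures are regarded as tempered distributions. For $\rho\in P(\mathbb{R}^3)$ and $s\ge 1$ put $$I_s(\rho)=\iint_{\mathbb{R}^3\times\mathbb{R}^3}\frac{|x|^s+|y|^s}{2|x-y|}\,d\rho(x)\,d\rho(y)\in[0,\infty].$$ The radial part $\overline\rho\in P(\mathbb{R}^3)$ of $\rho$ is defined by $$\int f\,d\overline\rho=\int_{\mathbb{R}^3}\int_{SO(3)}f(U^{-1}x)\,dU\,d\rho(x)\qquad\text{for all bounded measurable } f,$$ where $dU$ is the normalized Haar measure on $SO(3)$, and $\rho$ is called radial if $\rho=\overline\rho$. Let $$D_s=\Big\{\mu\in P(\mathbb{R}^3)\cap H^{-1}(\mathbb{R}^3):\ \int|x|^{s-1}\,d\mu(x)<\infty\Big\},\qquad D_{s,\mathrm{rad}}=\{\mu\in D_s:\ \mu \text{ is radial}\},$$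 $$\beta_s=\inf_{\mu\in D_s}\frac{I_s(\mu)}{\int|x|^{s-1}\,d\mu(x)},\qquad \beta_s^{\mathrm{rad}}=\inf_{\mu\in D_{s,\mathrm{rad}}}\frac{I_s(\mu)}{\int|x|^{s-1}\,d\mu(x)}.$$ Then for every $1\le s\le 3$: (i) $\beta_s=\beta_s^{\mathrm{rad}}$; (ii) $I_s(\rho)\ge I_s(\overline\rho)$ for every $\rho\in P(\mathbb{R}^3)\cap H^{-1}(\mathbb{R}^3)$. -/

import Mathlib

open MeasureTheory
open scoped ENNReal

noncomputable section

/-- Euclidean three-space `ℝ³`. -/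
abbrev E3 : Type := EuclideanSpace ℝ (Fin 3)

/-- The rotation group `SO(3)`, with the topology of entrywise convergence. -/
abbrev SO3 : Type := Matrix.specialOrthogonalGroup (Fin 3) ℝ

instance SO3.instMeasurableSpace : MeasurableSpace SO3 := borel SO3

instance SO3.instBorelSpace : BorelSpace SO3 := ⟨rfl⟩

theorem SO3.coe_inv (U : SO3) :
    ((U⁻¹ : SO3) : Matrix (Fin 3) (Fin 3) ℝ) = star (U : Matrix (Fin 3) (Fin 3) ℝ) := rfl

instance SO3.instIsTopologicalGroup : IsTopologicalGroup SO3 where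
  continuous_inv := by
    refine Continuous.subtype_mk (f := fun U : SO3 => star (U : Matrix (Fin 3) (Fin 3) ℝ)) ?_ _
    exact continuous_star.comp continuous_subtype_val

instance SO3.instSecondCountableTopology : SecondCountableTopology SO3 := by
  have : SecondCountableTopology (Matrix (Fin 3) (Fin 3) ℝ) :=
    inferInstanceAs (SecondCountableTopology (Fin 3 → Fin 3 → ℝ))
  exact TopologicalSpace.Subtype.secondCountableTopology _

theorem SO3.isCompact :
    IsCompact (Matrix.specialOrthogonalGroup (Fin 3) ℝ : Set (Matrix (Fin 3) (Fin 3) ℝ)) := by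
  have hK : IsCompact (Set.pi Set.univ fun _ : Fin 3 =>
      Set.pi Set.univ fun _ : Fin 3 => Set.Icc (-1 : ℝ) 1) :=
    isCompact_univ_pi fun _ => isCompact_univ_pi fun _ => isCompact_Icc
  refine IsCompact.of_isClosed_subset (X := Matrix (Fin 3) (Fin 3) ℝ) hK ?_ ?_
  · have h : (Matrix.specialOrthogonalGroup (Fin 3) ℝ : Set (Matrix (Fin 3) (Fin 3) ℝ)) =
        {A | A * star A = 1} ∩ {A | A.det = 1} := by
      ext A
      simp only [SetLike.mem_coe, Matrix.mem_specialOrthogonalGroup_iff,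
        Matrix.mem_orthogonalGroup_iff, Set.mem_inter_iff, Set.mem_ofPred_eq]
      rfl
    rw [h]
    refine IsClosed.inter (isClosed_eq ?_ continuous_const) (isClosed_eq ?_ continuous_const)
    · exact continuous_id.mul continuous_star
    · exact Continuous.matrix_det continuous_id
  · intro A hA i _ j _
    have hA' := (Matrix.mem_specialOrthogonalGroup_iff.1 hA).1
    have := entry_norm_bound_of_unitary (𝕜 := ℝ) hA' i j
    rw [Real.norm_eq_abs] at this
    exact abs_le.1 this

instance SO3.instCompactSpace : CompactSpace SO3 := isCompact_iff_compactSpace.1 SO3.isCompact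

/-- The normalized (total mass one) Haar measure on `SO(3)`. -/
def SO3.haar : Measure SO3 := Measure.haarMeasure ⊤

instance SO3.instIsProbabilityMeasureHaar : IsProbabilityMeasure SO3.haar :=
  ⟨Measure.haarMeasure_self (K₀ := (⊤ : TopologicalSpace.PositiveCompacts SO3))⟩

/-- The action of a rotation `U` on a vector `x`, i.e. the matrix-vector product `U x`. -/
def SO3.rotate (U : SO3) (x : E3) : E3 :=
  WithLp.toLp 2 ((U : Matrix (Fin 3) (Fin 3) ℝ).mulVec x.ofLp)

/-- The map `(U, x) ↦ U⁻¹ x`. -/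
def SO3.rotateInv (p : SO3 × E3) : E3 := SO3.rotate p.1⁻¹ p.2

theorem SO3.continuous_rotateInv : Continuous SO3.rotateInv := by
  refine (PiLp.continuous_toLp 2 _).comp ?_
  refine Continuous.matrix_mulVec ?_ ?_
  · exact continuous_subtype_val.comp (continuous_inv.comp continuous_fst)
  · exact (PiLp.continuous_ofLp 2 _).comp continuous_snd

theorem SO3.measurable_rotateInv : Measurable SO3.rotateInv :=
  SO3.continuous_rotateInv.measurable

/-- The radial part of a probability measure `ρ`: its average over `SO(3)`, that is, the law of
`U⁻¹ x` for `(U, x)` distributed according to `dU ⊗ ρ`. -/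
def radialPart (ρ : ProbabilityMeasure E3) : ProbabilityMeasure E3 :=
  ⟨(SO3.haar.prod (ρ : Measure E3)).map SO3.rotateInv, by
    have := Measure.prod.instIsProbabilityMeasure SO3.haar (ρ : Measure E3)
    exact Measure.isProbabilityMeasure_map SO3.measurable_rotateInv.aemeasurable⟩

/-- The defining property of the radial part: `∫ f dρ̄ = ∫ ∫ f (U⁻¹ x) dU dρ(x)`. -/
theorem lintegral_radialPart (ρ : ProbabilityMeasure E3) {f : E3 → ℝ≥0∞} (hf : Measurable f) :
    ∫⁻ x, f x ∂(radialPart ρ : Measure E3) =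
      ∫⁻ x, ∫⁻ U, f (SO3.rotate U⁻¹ x) ∂SO3.haar ∂(ρ : Measure E3) := by
  change ∫⁻ x, f x ∂((SO3.haar.prod (ρ : Measure E3)).map SO3.rotateInv) = _
  rw [lintegral_map hf SO3.measurable_rotateInv,
    lintegral_prod_symm (fun p => f (SO3.rotateInv p))
      (hf.comp SO3.measurable_rotateInv).aemeasurable]
  rfl

/-- A probability measure is radial if it equals its radial part. -/
def IsRadial (ρ : ProbabilityMeasure E3) : Prop := ρ = radialPart ρ

/-- The probability measure `ρ`, viewed as a tempered distribution, belongs to the Sobolev space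
`H⁻¹(ℝ³)`. -/
def MemHNegOne (ρ : ProbabilityMeasure E3) : Prop :=
  TemperedDistribution.MemSobolev (-1) 2 (ρ : Measure E3).toTemperedDistribution

/-- The moment `∫ |x|^t dρ(x)`, with values in `[0, ∞]`. -/
def absMoment (t : ℝ) (ρ : ProbabilityMeasure E3) : ℝ≥0∞ :=
  ∫⁻ x, ENNReal.ofReal (‖x‖ ^ t) ∂(ρ : Measure E3)

/-- The energy `I_s(ρ) = ∬ (|x|^s + |y|^s) / (2 |x - y|) dρ(x) dρ(y)`, with values in `[0, ∞]`;
the integrand is `∞` when `x = y ≠ 0`. -/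
def weightedEnergy (s : ℝ) (ρ : ProbabilityMeasure E3) : ℝ≥0∞ :=
  ∫⁻ x, ∫⁻ y, ENNReal.ofReal (‖x‖ ^ s + ‖y‖ ^ s) / ENNReal.ofReal (2 * ‖x - y‖)
    ∂(ρ : Measure E3) ∂(ρ : Measure E3)

/-- The admissible class `D_s`: the probability measures in `H⁻¹(ℝ³)` with finite moment of
order `s - 1`. -/
def admissible (s : ℝ) : Set (ProbabilityMeasure E3) :=
  {μ | MemHNegOne μ ∧ absMoment (s - 1) μ < ∞}

/-- `β_s`, the infimum of `I_s(μ) / ∫ |x|^(s-1) dμ(x)` over the admissible class. -/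
def beta (s : ℝ) : ℝ≥0∞ :=
  ⨅ μ ∈ admissible s, weightedEnergy s μ / absMoment (s - 1) μ

/-- `β_s^rad`, the same infimum over the radial measures in the admissible class. -/
def betaRad (s : ℝ) : ℝ≥0∞ :=
  ⨅ μ ∈ {μ ∈ admissible s | IsRadial μ}, weightedEnergy s μ / absMoment (s - 1) μ

end

/-! The kernel of $I_s$ expands in zonal harmonics as $\sum_n K_n$, where
$K_n(x,y)=\frac{|x|^s+|y|^s}{2}\,\frac{|x|^n|y|^n P_n(\cos\angle(x,y))}{\max(|x|,|y|)^{2n+1}}$. The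
term $K_0$ depends on the norms only, so it does not distinguish $\rho$ from $\overline\rho$.

For $n\ge1$ and $s\le 2n+1$ the kernel $K_n$ is of positive type (`kernelForm_zonalKernel_nonneg`).
Its angular factor is a finite sum of products $h_\alpha(x)h_\alpha(y)$ (`exists_zonal_eq_sum`), and
its radial factor is a sum of two kernels of the form $g(x)g(y)\min(a(x),a(y))$
(`radial_weight_eq`). The hypothesis $s\le3$ is the condition at $n=1$. Test positivity on
$\rho-\overline\rho$: by rotation invariance the mixed integral equals the one over
$\overline\rho\otimes\overline\rho$ (`integral_prod_radialPart_eq`), so what remains is $\int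
K_n\,d\rho\,d\rho\ge\int K_n\,d\overline\rho\,d\overline\rho$.

The terms are summed with Abel weights $\eta^n$, $\eta<1$, which amounts to shrinking the shorter of
the two vectors by $\eta$; then $\eta\to1$ (`weightedEnergy_radialPart_le`). This gives (ii). For
(i), passing to the radial part keeps the moment and membership in $H^{-1}$
(`memHNegOne_radialPart`) and does not raise the energy. -/

open MeasureTheory
open scoped ENNReal

noncomputable section

/-! ### Zonal solid harmonics as polynomials: homogeneity and harmonicity. -/

section ZonalPolynomials

open MvPolynomial

/-- The linear form `X ↦ ⟨v, X⟩`. -/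
def linForm (v : Fin 3 → ℝ) : MvPolynomial (Fin 3) ℝ := ∑ i, C (v i) * X i

/-- The squared Euclidean norm as a polynomial. -/
def normSqPoly : MvPolynomial (Fin 3) ℝ := ∑ i, X i ^ 2

/-- The squared Euclidean norm of a vector, as a constant polynomial. -/
def normSqConst (v : Fin 3 → ℝ) : MvPolynomial (Fin 3) ℝ := C (∑ i, v i ^ 2)

/-- The zonal solid harmonic `X ↦ |v|ⁿ |X|ⁿ Pₙ(cos ∠(v, X))`, with `Pₙ` the Legendre polynomial. -/
def zonalPoly (v : Fin 3 → ℝ) : ℕ → MvPolynomial (Fin 3) ℝ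
  | 0 => 1
  | 1 => linForm v
  | n + 2 => C ((n + 2 : ℝ)⁻¹) * ((2 * (n : MvPolynomial (Fin 3) ℝ) + 3) * linForm v * zonalPoly v (n + 1)
      - ((n : MvPolynomial (Fin 3) ℝ) + 1) * normSqConst v * normSqPoly * zonalPoly v n)

theorem zonalPoly_zero (v : Fin 3 → ℝ) : zonalPoly v 0 = 1 := by rw [zonalPoly]

theorem zonalPoly_one (v : Fin 3 → ℝ) : zonalPoly v 1 = linForm v := by rw [zonalPoly]

theorem C_natCast_add_two_inv_mul (n : ℕ) :
    (n + 2 : MvPolynomial (Fin 3) ℝ) * C ((n + 2 : ℝ)⁻¹) = 1 := by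
  have h : (n + 2 : MvPolynomial (Fin 3) ℝ) = C (n + 2 : ℝ) := by
    rw [map_add, map_natCast, map_ofNat]
  rw [h, ← C_mul, mul_inv_cancel₀ (by positivity), C_1]

theorem zonalPoly_add_two (v : Fin 3 → ℝ) (n : ℕ) :
    (n + 2) * zonalPoly v (n + 2) = (2 * n + 3) * linForm v * zonalPoly v (n + 1)
      - (n + 1) * normSqConst v * normSqPoly * zonalPoly v n := by
  rw [zonalPoly]
  linear_combination (C_natCast_add_two_inv_mul n) * ((2 * n + 3) * linForm v * zonalPoly v (n + 1)
      - (n + 1) * normSqConst v * normSqPoly * zonalPoly v n)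

theorem natCast_add_two_ne_zero (n : ℕ) : (n + 2 : MvPolynomial (Fin 3) ℝ) ≠ 0 := fun h => by
  have := C_natCast_add_two_inv_mul n
  rw [h, zero_mul] at this
  exact zero_ne_one this

theorem isHomogeneous_linForm (v : Fin 3 → ℝ) : (linForm v).IsHomogeneous 1 :=
  IsHomogeneous.sum _ _ _ fun i _ => by
    simpa using (isHomogeneous_C (Fin 3) (v i)).mul (isHomogeneous_X ℝ i)

theorem isHomogeneous_normSqPoly : normSqPoly.IsHomogeneous 2 :=
  IsHomogeneous.sum _ _ _ fun i _ => by simpa using (isHomogeneous_X ℝ i).pow 2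

theorem isHomogeneous_zonalPoly (v : Fin 3 → ℝ) (n : ℕ) : (zonalPoly v n).IsHomogeneous n := by
  induction n using Nat.twoStepInduction with
  | zero => rw [zonalPoly_zero]; exact isHomogeneous_one _ _
  | one => rw [zonalPoly_one]; exact isHomogeneous_linForm v
  | more n h0 h1 =>
    have e1 : (2 * n + 3 : MvPolynomial (Fin 3) ℝ) = C (2 * n + 3 : ℝ) := by
      rw [map_add, map_mul, map_natCast, map_ofNat, map_ofNat]
    have e2 : (n + 1 : MvPolynomial (Fin 3) ℝ) = C (n + 1 : ℝ) := by simp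
    rw [zonalPoly, e1, e2, normSqConst]
    have a := (((isHomogeneous_C (Fin 3) (2 * n + 3 : ℝ)).mul (isHomogeneous_linForm v)).mul h1)
    have b := ((((isHomogeneous_C (Fin 3) (n + 1 : ℝ)).mul
      (isHomogeneous_C (Fin 3) (∑ i, v i ^ 2))).mul isHomogeneous_normSqPoly).mul h0)
    have a' : (0 + 1 + (n + 1)) = n + 2 := by ring
    have b' : (0 + 0 + 2 + n) = n + 2 := by ring
    rw [a'] at a
    rw [b'] at b
    simpa using (isHomogeneous_C (Fin 3) ((n + 2 : ℝ)⁻¹)).mul (a.sub b)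

/-- The derivative in direction `v`. -/
def dirDeriv (v : Fin 3 → ℝ) : Derivation ℝ (MvPolynomial (Fin 3) ℝ) (MvPolynomial (Fin 3) ℝ) :=
  mkDerivation ℝ fun i => C (v i)

theorem dirDeriv_apply (v : Fin 3 → ℝ) (f : MvPolynomial (Fin 3) ℝ) :
    dirDeriv v f = ∑ i, C (v i) * pderiv i f := by
  have h : dirDeriv v = ∑ i, v i • pderiv i := by
    refine derivation_ext fun j => ?_
    rw [dirDeriv, mkDerivation_X]
    simp [pderiv_X, Fin.sum_univ_three, Pi.single_apply, MvPolynomial.smul_eq_C_mul]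
    fin_cases j <;> simp
  rw [h]
  simp [Fin.sum_univ_three, MvPolynomial.smul_eq_C_mul]

theorem dirDeriv_linForm (v : Fin 3 → ℝ) : dirDeriv v (linForm v) = normSqConst v := by
  simp [dirDeriv, linForm, normSqConst, Fin.sum_univ_three, mkDerivation_X]
  ring

theorem dirDeriv_normSqPoly (v : Fin 3 → ℝ) : dirDeriv v normSqPoly = 2 * linForm v := by
  simp [dirDeriv, linForm, normSqPoly, Fin.sum_univ_three, mkDerivation_X,
    Derivation.leibniz_pow]
  ring

theorem dirDeriv_normSqConst (v w : Fin 3 → ℝ) : dirDeriv v (normSqConst w) = 0 :=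
  derivation_C _ _

/-- Obtained by differentiating the three-term recursion. It evaluates the cross term $2\,\partial_v
Z_{n+1}$ in the Laplacian of $\langle v,X\rangle Z_{n+1}$. -/
theorem dirDeriv_zonalPoly (v : Fin 3 → ℝ) (n : ℕ) :
    dirDeriv v (zonalPoly v (n + 1)) = (n + 1) * normSqConst v * zonalPoly v n := by
  induction n using Nat.twoStepInduction with
  | zero => simp [zonalPoly_one, zonalPoly_zero, dirDeriv_linForm]
  | one =>
    have h := congrArg (dirDeriv v) (zonalPoly_add_two v 0)
    have q2 : dirDeriv v (2 : MvPolynomial (Fin 3) ℝ) = 0 := Derivation.map_natCast _ 2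
    have q3 : dirDeriv v (3 : MvPolynomial (Fin 3) ℝ) = 0 := Derivation.map_natCast _ 3
    apply mul_left_cancel₀ (natCast_add_two_ne_zero 0)
    simp [zonalPoly_one, zonalPoly_zero, dirDeriv_linForm, dirDeriv_normSqPoly,
      dirDeriv_normSqConst, Derivation.leibniz, q2, q3] at h
    rw [zonalPoly_one]
    push_cast
    linear_combination h
  | more n h0 h1 =>
    have h := congrArg (dirDeriv v) (zonalPoly_add_two v (n + 1))
    have h2 := zonalPoly_add_two v n
    have q2 : dirDeriv v (2 : MvPolynomial (Fin 3) ℝ) = 0 := Derivation.map_natCast _ 2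
    have q3 : dirDeriv v (3 : MvPolynomial (Fin 3) ℝ) = 0 := Derivation.map_natCast _ 3
    have q0 : dirDeriv v (n : MvPolynomial (Fin 3) ℝ) = 0 := Derivation.map_natCast _ n
    apply mul_left_cancel₀ (natCast_add_two_ne_zero (n + 1))
    simp only [Derivation.leibniz, map_add, map_sub, h0, h1, q0, q2, q3, dirDeriv_linForm,
      dirDeriv_normSqPoly, dirDeriv_normSqConst, smul_eq_mul, Derivation.map_one_eq_zero,
      Nat.cast_add, Nat.cast_one, mul_zero, add_zero, Nat.cast_ofNat] at h ⊢
    linear_combination h - (n + 2) * normSqConst v * h2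

/-- The Laplacian on polynomials. -/
def laplacePoly (f : MvPolynomial (Fin 3) ℝ) : MvPolynomial (Fin 3) ℝ :=
  ∑ i, pderiv i (pderiv i f)

/-- Apply $\Delta$ to the recursion. By Euler's identity $\Delta(|X|^2Z_n)=(4n+6)Z_n+|X|^2\Delta
Z_n$, and this cancels against $2(2n+3)\,\partial_vZ_{n+1}=2(2n+3)(n+1)|v|^2Z_n$. -/
theorem laplacePoly_zonalPoly (v : Fin 3 → ℝ) (n : ℕ) : laplacePoly (zonalPoly v n) = 0 := by
  induction n using Nat.twoStepInduction with
  | zero => simp [zonalPoly_zero, laplacePoly]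
  | one => simp [zonalPoly_one, laplacePoly, linForm, Fin.sum_univ_three, pderiv_X, Pi.single_apply]
  | more n h0 h1 =>
    apply mul_left_cancel₀ (natCast_add_two_ne_zero n)
    have h := congrArg laplacePoly (zonalPoly_add_two v n)
    have hd := dirDeriv_zonalPoly v n
    have he := (isHomogeneous_zonalPoly v n).sum_X_mul_pderiv
    simp only [laplacePoly, dirDeriv_apply, Fin.sum_univ_three] at h h0 h1 hd he ⊢
    have p0 (i : Fin 3) : pderiv i (n : MvPolynomial (Fin 3) ℝ) = 0 := Derivation.map_natCast _ _
    have p1 (i : Fin 3) : pderiv i (linForm v) = C (v i) := by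
      simp [linForm, Fin.sum_univ_three, pderiv_X, Pi.single_apply]; fin_cases i <;> simp
    have p2 (i : Fin 3) : pderiv i normSqPoly = 2 * X i := by
      simp [normSqPoly, Fin.sum_univ_three, pderiv_X, Pi.single_apply, Derivation.leibniz_pow]
      fin_cases i <;> simp
    have p3 (i : Fin 3) : pderiv i (normSqConst v) = 0 := pderiv_C
    have q2 (i : Fin 3) : pderiv i (2 : MvPolynomial (Fin 3) ℝ) = 0 := Derivation.map_natCast _ 2
    have q3 (i : Fin 3) : pderiv i (3 : MvPolynomial (Fin 3) ℝ) = 0 := Derivation.map_natCast _ 3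
    simp only [Derivation.leibniz, map_add, map_sub, p0, p1, p2, p3, q2, q3, smul_eq_mul,
      pderiv_C, pderiv_X_self, pderiv_one, mul_zero, add_zero, zero_add, mul_one] at h
    rw [mul_zero]
    simp only [nsmul_eq_mul] at he
    linear_combination h + (2 * n + 3) * linForm v * h1
      - (n + 1) * normSqConst v * normSqPoly * h0
      + 2 * (2 * n + 3) * hd - 4 * (n + 1) * normSqConst v * he

end ZonalPolynomials

/-! ### The Fischer product and the reproducing property of zonal harmonics. -/

section FischerProduct

open MvPolynomial
open scoped Nat

/-- The weight `α!` of the monomial `X ^ α` in the Fischer product. -/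
def fischerWeight (α : Fin 3 →₀ ℕ) : ℝ := ∏ i, ((α i)! : ℝ)

/-- The Fischer product `f ↦ ⟨f, g⟩ = (f(∂) g)(0)`. -/
def fischer (g : MvPolynomial (Fin 3) ℝ) : MvPolynomial (Fin 3) ℝ →ₗ[ℝ] ℝ :=
  (basisMonomials (Fin 3) ℝ).constr ℝ fun α => fischerWeight α * coeff α g

theorem fischerWeight_nonneg (α : Fin 3 →₀ ℕ) : 0 ≤ fischerWeight α :=
  Finset.prod_nonneg fun _ _ => by positivity

theorem fischerWeight_single_add (i : Fin 3) (α : Fin 3 →₀ ℕ) :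
    fischerWeight (Finsupp.single i 1 + α) = (α i + 1) * fischerWeight α := by
  fin_cases i <;>
    simp [fischerWeight, Fin.prod_univ_three, add_comm 1, Nat.factorial_succ] <;> ring

theorem fischer_monomial (g : MvPolynomial (Fin 3) ℝ) (α : Fin 3 →₀ ℕ) (a : ℝ) :
    fischer g (monomial α a) = a * (fischerWeight α * coeff α g) := by
  have h : monomial α a = a • basisMonomials (Fin 3) ℝ α := by
    simp [smul_monomial]
  rw [h, map_smul, fischer, Module.Basis.constr_basis, smul_eq_mul]

theorem fischer_apply (g f : MvPolynomial (Fin 3) ℝ) :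
    fischer g f = ∑ α ∈ f.support, coeff α f * (fischerWeight α * coeff α g) := by
  conv_lhs => rw [f.as_sum]
  rw [map_sum]
  exact Finset.sum_congr rfl fun α _ => fischer_monomial _ _ _

theorem fischer_zero (f : MvPolynomial (Fin 3) ℝ) : fischer 0 f = 0 := by
  simp [fischer_apply]

theorem fischer_sum (g : Fin 3 → MvPolynomial (Fin 3) ℝ) (f : MvPolynomial (Fin 3) ℝ) :
    fischer (∑ i, g i) f = ∑ i, fischer (g i) f := by
  simp only [fischer_apply, coeff_sum, Finset.mul_sum]
  exact Finset.sum_comm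

/-- Multiplication by $X_i$ is adjoint to $\partial_i$; the weights $\alpha!$ are chosen for this.
-/
theorem fischer_X_mul (i : Fin 3) (g f : MvPolynomial (Fin 3) ℝ) :
    fischer g (X i * f) = fischer (pderiv i g) f := by
  induction f using MvPolynomial.induction_on' with
  | monomial α a =>
    rw [X, monomial_mul, fischer_monomial, fischer_monomial, fischerWeight_single_add,
      coeff_pderiv, add_comm (Finsupp.single i 1)]
    ring
  | add p q hp hq => rw [mul_add, map_add, map_add, hp, hq]

theorem fischer_C_mul (a : ℝ) (g f : MvPolynomial (Fin 3) ℝ) :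
    fischer g (C a * f) = a * fischer g f := by
  rw [← smul_eq_C_mul, map_smul, smul_eq_mul]

/-- Moving the $n$ factors across turns them into $\partial_v$, and Euler's identity at $v$ gives
one factor of the factorial at each step. -/
theorem fischer_linForm_pow (v : Fin 3 → ℝ) (n : ℕ) (g : MvPolynomial (Fin 3) ℝ)
    (hg : g.IsHomogeneous n) : fischer g (linForm v ^ n) = n ! * eval v g := by
  induction n generalizing g with
  | zero =>
    have h1 : (1 : MvPolynomial (Fin 3) ℝ) = monomial 0 1 := rfl
    have h2 : g = C (coeff 0 g) :=
      totalDegree_eq_zero_iff_eq_C.1 (Nat.le_zero.1 hg.totalDegree_le)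
    rw [pow_zero, h1, fischer_monomial, h2]
    simp [fischerWeight]
  | succ n ih =>
    have he := congrArg (eval v) hg.sum_X_mul_pderiv
    have h1 : linForm v ^ (n + 1) = ∑ i, C (v i) * (X i * linForm v ^ n) := by
      rw [pow_succ', linForm, Finset.sum_mul]
      exact Finset.sum_congr rfl fun i _ => by ring
    have h2 (i : Fin 3) : fischer (pderiv i g) (linForm v ^ n) = n ! * eval v (pderiv i g) :=
      ih _ hg.pderiv
    simp only [h1, map_sum, fischer_C_mul, fischer_X_mul, h2]
    simp only [map_sum, map_mul, eval_X, nsmul_eq_mul, map_natCast] at he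
    rw [Nat.factorial_succ, Nat.cast_mul]
    calc ∑ i, v i * (n ! * eval v (pderiv i g))
        = n ! * ∑ i, v i * eval v (pderiv i g) := by
          rw [Finset.mul_sum]; exact Finset.sum_congr rfl fun i _ => by ring
      _ = _ := by rw [he]; ring

theorem fischer_normSqPoly_mul (g f : MvPolynomial (Fin 3) ℝ) :
    fischer g (normSqPoly * f) = fischer (laplacePoly g) f := by
  have h1 : normSqPoly * f = ∑ i, X i * (X i * f) := by
    rw [normSqPoly, Finset.sum_mul]
    exact Finset.sum_congr rfl fun i _ => by ring
  rw [h1, laplacePoly, map_sum, fischer_sum]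
  simp only [fischer_X_mul]

/-- Modulo $|X|^2$ the recursion loses its second term, so each step only multiplies by $\langle
v,X\rangle$ and a positive constant independent of $v$. -/
theorem exists_zonalPoly_eq (n : ℕ) : ∃ b : ℝ, 0 < b ∧ ∀ v, ∃ W,
    zonalPoly v n = C b * linForm v ^ n + normSqPoly * W := by
  induction n using Nat.twoStepInduction with
  | zero => exact ⟨1, one_pos, fun v => ⟨0, by simp [zonalPoly_zero]⟩⟩
  | one => exact ⟨1, one_pos, fun v => ⟨0, by simp [zonalPoly_one]⟩⟩
  | more n _ h1 =>
    obtain ⟨b, hb, h⟩ := h1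
    refine ⟨(n + 2 : ℝ)⁻¹ * ((2 * n + 3) * b), by positivity, fun v => ?_⟩
    obtain ⟨W, hW⟩ := h v
    refine ⟨C ((n + 2 : ℝ)⁻¹) * ((2 * (n : MvPolynomial (Fin 3) ℝ) + 3) * linForm v * W
      - ((n : MvPolynomial (Fin 3) ℝ) + 1) * normSqConst v * zonalPoly v n), ?_⟩
    rw [zonalPoly, hW]
    simp only [map_mul, map_add, map_natCast, map_ofNat]
    ring

/-- The multiple of $|X|^2$ in $Z_v$ pairs to zero with the harmonic $Z_w$, and the power of
$\langle v,X\rangle$ evaluates $Z_w$ at $v$. Thus $Z_w(v)$ is, up to a positive factor, a Gram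
kernel. -/
theorem exists_fischer_zonalPoly (n : ℕ) : ∃ b : ℝ, 0 < b ∧ ∀ v w,
    fischer (zonalPoly w n) (zonalPoly v n) = b * eval v (zonalPoly w n) := by
  obtain ⟨b, hb, h⟩ := exists_zonalPoly_eq n
  refine ⟨b * n !, by positivity, fun v w => ?_⟩
  obtain ⟨W, hW⟩ := h v
  rw [hW, map_add, fischer_C_mul, fischer_normSqPoly_mul, laplacePoly_zonalPoly, fischer_zero,
    fischer_linForm_pow v n _ (isHomogeneous_zonalPoly w n)]
  ring

theorem continuous_coeff_zonalPoly (n : ℕ) (α : Fin 3 →₀ ℕ) :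
    Continuous fun v => coeff α (zonalPoly v n) := by
  have hX {f : (Fin 3 → ℝ) → MvPolynomial (Fin 3) ℝ} (hf : ∀ α, Continuous fun v => coeff α (f v))
      (i : Fin 3) (α : Fin 3 →₀ ℕ) : Continuous fun v => coeff α (X i * f v) := by
    simp only [coeff_X_mul']
    split_ifs
    · exact hf _
    · exact continuous_const
  have hC {f : (Fin 3 → ℝ) → MvPolynomial (Fin 3) ℝ} (hf : ∀ α, Continuous fun v => coeff α (f v))
      {c : (Fin 3 → ℝ) → ℝ} (hc : Continuous c) (α : Fin 3 →₀ ℕ) :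
      Continuous fun v => coeff α (C (c v) * f v) := by
    simp only [coeff_C_mul]
    exact hc.mul (hf α)
  have hL {f : (Fin 3 → ℝ) → MvPolynomial (Fin 3) ℝ} (hf : ∀ α, Continuous fun v => coeff α (f v))
      (α : Fin 3 →₀ ℕ) : Continuous fun v => coeff α (linForm v * f v) := by
    simp only [linForm, Finset.sum_mul, coeff_sum, mul_assoc]
    exact continuous_finsetSum _ fun i _ => hC (hX hf i) (continuous_apply i) α
  have hN {f : (Fin 3 → ℝ) → MvPolynomial (Fin 3) ℝ} (hf : ∀ α, Continuous fun v => coeff α (f v))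
      (α : Fin 3 →₀ ℕ) : Continuous fun v => coeff α (normSqPoly * f v) := by
    simp only [normSqPoly, Finset.sum_mul, coeff_sum, pow_two, mul_assoc]
    exact continuous_finsetSum _ fun i _ => hX (hX hf i) i α
  have h1 (α : Fin 3 →₀ ℕ) :
      Continuous fun _ : Fin 3 → ℝ => coeff α (1 : MvPolynomial (Fin 3) ℝ) := continuous_const
  induction n using Nat.twoStepInduction generalizing α with
  | zero => simpa only [zonalPoly_zero] using h1 α
  | one => simpa only [zonalPoly_one, mul_one] using hL h1 α
  | more n h0 h2 =>
    have e (v : Fin 3 → ℝ) : coeff α (zonalPoly v (n + 2)) = (n + 2 : ℝ)⁻¹ *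
        ((2 * n + 3) * coeff α (linForm v * zonalPoly v (n + 1))
          - (n + 1) * coeff α (C (∑ i, v i ^ 2) * (normSqPoly * zonalPoly v n))) := by
      have e1 : (2 * n + 3 : MvPolynomial (Fin 3) ℝ) = C (2 * n + 3 : ℝ) := by
        rw [map_add, map_mul, map_natCast, map_ofNat, map_ofNat]
      have e2 : (n + 1 : MvPolynomial (Fin 3) ℝ) = C (n + 1 : ℝ) := by simp
      rw [zonalPoly, e1, e2, coeff_C_mul, coeff_sub, mul_assoc, coeff_C_mul, mul_assoc, mul_assoc,
        coeff_C_mul, normSqConst]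
    simp only [e]
    refine continuous_const.mul ((continuous_const.mul (hL h2 α)).sub
      (continuous_const.mul (hC (hN h0) ?_ α)))
    fun_prop

/-- The solid zonal harmonic as a function of `c = ⟨x, y⟩` and `d = |x|² |y|²`. -/
def solidLegendre (c d : ℝ) : ℕ → ℝ
  | 0 => 1
  | 1 => c
  | n + 2 => (n + 2 : ℝ)⁻¹ * ((2 * n + 3) * c * solidLegendre c d (n + 1)
      - (n + 1) * d * solidLegendre c d n)

theorem eval_zonalPoly (v x : Fin 3 → ℝ) (n : ℕ) : eval x (zonalPoly v n) =
    solidLegendre (∑ i, v i * x i) ((∑ i, v i ^ 2) * ∑ i, x i ^ 2) n := by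
  induction n using Nat.twoStepInduction with
  | zero => simp [zonalPoly_zero, solidLegendre]
  | one => simp [zonalPoly_one, solidLegendre, linForm]
  | more n h0 h1 =>
    rw [zonalPoly, solidLegendre, ← h0, ← h1]
    simp only [linForm, normSqConst, normSqPoly, map_mul, map_sub, map_add, map_sum, map_pow,
      eval_C, eval_X, map_natCast, map_ofNat, map_one]
    ring

end FischerProduct

/-! ### Addition theorem, Legendre bound and generating function. -/

/-- The zonal solid harmonic `|x|ⁿ |y|ⁿ Pₙ(cos ∠(x, y))`. -/
def zonal (n : ℕ) (x y : E3) : ℝ := solidLegendre (inner ℝ x y) (‖x‖ ^ 2 * ‖y‖ ^ 2) n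

theorem zonal_eq_eval (n : ℕ) (x y : E3) :
    zonal n x y = MvPolynomial.eval x.ofLp (zonalPoly y.ofLp n) := by
  rw [eval_zonalPoly, zonal, EuclideanSpace.real_norm_sq_eq, EuclideanSpace.real_norm_sq_eq,
    mul_comm (∑ i, x.ofLp i ^ 2)]
  simp [PiLp.inner_apply]

/-- The addition theorem: zonal harmonics are finite sums of squares. -/
theorem exists_zonal_eq_sum (n : ℕ) : ∃ (S : Finset (Fin 3 →₀ ℕ)) (h : (Fin 3 →₀ ℕ) → E3 → ℝ),
    (∀ α, Continuous (h α)) ∧ ∀ x y, zonal n x y = ∑ α ∈ S, h α x * h α y := by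
  obtain ⟨b, hb, hF⟩ := exists_fischer_zonalPoly n
  -- The index set consists of all exponents of degree $n$. The functions $h_\alpha$ are the
  -- coefficients of $Z_x$, scaled so that the weighted Fischer sum becomes a plain sum of products.
  refine ⟨Finset.finsuppAntidiag Finset.univ n, fun α x =>
    √(b⁻¹ * fischerWeight α) * MvPolynomial.coeff α (zonalPoly x.ofLp n),
    fun α => continuous_const.mul
      ((continuous_coeff_zonalPoly n α).comp (PiLp.continuous_ofLp 2 _)), fun x y => ?_⟩
  have h1 := hF x.ofLp y.ofLp
  rw [← zonal_eq_eval, fischer_apply] at h1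
  -- The support depends on `x`; homogeneity places it inside a fixed set.
  rw [Finset.sum_subset (s₂ := Finset.finsuppAntidiag Finset.univ n) _ _] at h1
  · rw [← mul_right_inj' hb.ne', ← h1, Finset.mul_sum]
    refine Finset.sum_congr rfl fun α _ => ?_
    have h2 := Real.mul_self_sqrt (mul_nonneg (inv_nonneg.2 hb.le) (fischerWeight_nonneg α))
    have h3 : b * b⁻¹ = 1 := mul_inv_cancel₀ hb.ne'
    linear_combination
      (-b * MvPolynomial.coeff α (zonalPoly x.ofLp n) * MvPolynomial.coeff α (zonalPoly y.ofLp n)) * h2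
      - fischerWeight α * MvPolynomial.coeff α (zonalPoly x.ofLp n)
        * MvPolynomial.coeff α (zonalPoly y.ofLp n) * h3
  · intro α hα
    have := (isHomogeneous_zonalPoly x.ofLp n) (MvPolynomial.mem_support_iff.1 hα)
    rw [Finset.mem_finsuppAntidiag]
    refine ⟨?_, Finset.subset_univ _⟩
    rw [← this, Finsupp.weight_apply, Finsupp.sum_fintype _ _ (by simp)]
    simp
  · intro α _ hα
    rw [MvPolynomial.notMem_support_iff.1 hα, zero_mul]

theorem solidLegendre_sq (t : ℝ) (n : ℕ) : solidLegendre t (t ^ 2) n = t ^ n := by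
  induction n using Nat.twoStepInduction with
  | zero => simp [solidLegendre]
  | one => simp [solidLegendre]
  | more n h0 h1 =>
    rw [solidLegendre, h0, h1]
    field_simp
    ring

theorem zonal_self (n : ℕ) (x : E3) : zonal n x x = ‖x‖ ^ (2 * n) := by
  rw [zonal, real_inner_self_eq_norm_sq, pow_mul, ← pow_two, solidLegendre_sq]

theorem abs_sum_mul_le {ι : Type*} (S : Finset ι) (f g : ι → ℝ) :
    |∑ i ∈ S, f i * g i| ≤ √(∑ i ∈ S, f i * f i) * √(∑ i ∈ S, g i * g i) := by
  rw [← Real.sqrt_mul (Finset.sum_nonneg fun i _ => mul_self_nonneg _)]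
  apply Real.abs_le_sqrt
  simpa only [pow_two] using Finset.sum_mul_sq_le_sq_mul_sq S f g

/-- This is $|P_n|\le1$: Cauchy–Schwarz in the addition theorem, together with the diagonal value
$P_n(1)=1$. -/
theorem abs_zonal_le (n : ℕ) (x y : E3) : |zonal n x y| ≤ ‖x‖ ^ n * ‖y‖ ^ n := by
  obtain ⟨S, h, _, hz⟩ := exists_zonal_eq_sum n
  have h1 := abs_sum_mul_le S (h · x) (h · y)
  rw [← hz, ← hz, ← hz, zonal_self, zonal_self, mul_comm 2, pow_mul, pow_mul,
    Real.sqrt_sq (by positivity), Real.sqrt_sq (by positivity)] at h1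
  exact h1

theorem solidLegendre_add_two (c d : ℝ) (n : ℕ) : (n + 2) * solidLegendre c d (n + 2) =
    (2 * n + 3) * c * solidLegendre c d (n + 1) - (n + 1) * d * solidLegendre c d n := by
  rw [solidLegendre]
  field_simp

/-- The generating function of the Legendre polynomials. -/
theorem hasSum_solidLegendre {c m w : ℝ} (hm : 0 ≤ m) (hc : |c| ≤ m)
    (hp : ∀ n, |solidLegendre c (m ^ 2) n| ≤ m ^ n) (hw : 0 ≤ w) (hmw : m * w < 1) :
    HasSum (fun n => solidLegendre c (m ^ 2) n * w ^ n) (√(1 - 2 * c * w + m ^ 2 * w ^ 2))⁻¹ := by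
  set p := solidLegendre c (m ^ 2) with hpdef
  -- A radius strictly between `w` and $1/m$ leaves room for termwise differentiation near `w`; the
  -- form of the witness also covers `m = 0`.
  obtain ⟨r, hwr, hmr⟩ : ∃ r, w < r ∧ m * r < 1 := by
    refine ⟨w + (1 - m * w) / (2 * (m + 1)), ?_, ?_⟩
    · have : 0 < (1 - m * w) / (2 * (m + 1)) := div_pos (by linarith) (by linarith)
      linarith
    · have h1 : m * ((1 - m * w) / (2 * (m + 1))) ≤ (1 - m * w) / 2 := by
        rw [mul_div_assoc', div_le_div_iff₀ (by positivity) (by positivity)]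
        nlinarith
      rw [mul_add]
      linarith
  have hr : 0 < r := hw.trans_lt hwr
  have hmr0 : 0 ≤ m * r := mul_nonneg hm hr.le
  have hu : Summable fun n : ℕ => r⁻¹ * ((n : ℝ) * (m * r) ^ n) := by
    have := summable_pow_mul_geometric_of_norm_lt_one (R := ℝ) 1 (r := m * r)
      (by rwa [Real.norm_of_nonneg hmr0])
    simpa using this.mul_left r⁻¹
  have hs {t : ℝ} (ht : |t| < r) : Summable fun n => p n * t ^ n := by
    refine Summable.of_norm_bounded (summable_geometric_of_lt_one hmr0 hmr) fun n => ?_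
    rw [norm_mul, norm_pow, Real.norm_eq_abs, Real.norm_eq_abs, mul_pow]
    gcongr
    exact hp n
  have hbd {n : ℕ} {t : ℝ} (ht : |t| < r) :
      ‖p n * (n * t ^ (n - 1))‖ ≤ r⁻¹ * ((n : ℝ) * (m * r) ^ n) := by
    rw [norm_mul, norm_mul, norm_pow, RCLike.norm_natCast, Real.norm_eq_abs, Real.norm_eq_abs]
    rcases n with _ | n
    · simp
    · have : r⁻¹ * (((n + 1 : ℕ) : ℝ) * (m * r) ^ (n + 1))
          = m ^ (n + 1) * (((n + 1 : ℕ) : ℝ) * r ^ n) := by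
        field_simp
        ring
      rw [this, Nat.add_sub_cancel]
      gcongr
      exact hp _
  have hd {t : ℝ} (ht : |t| < r) :
      HasDerivAt (fun t => ∑' n, p n * t ^ n) (∑' n, p n * (n * t ^ (n - 1))) t := by
    refine hasDerivAt_tsum_of_isPreconnected hu Metric.isOpen_ball
      (convex_ball (0 : ℝ) r).isPreconnected (fun n y _ => (hasDerivAt_pow n y).const_mul _)
      (fun n y hy => hbd (by simpa using hy)) (Metric.mem_ball_self hr)
      (hs (by simpa using hr)) (by simpa using ht)
  have hp0 : p 0 = 1 := by rw [hpdef, solidLegendre]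
  have hp1 : p 1 = c := by rw [hpdef, solidLegendre]
  -- The three-term recursion is the coefficient form of $(1-2ct+m^2t^2)f'=(c-m^2t)f$.
  have hode {t : ℝ} (ht : |t| < r) : (∑' n, p n * (n * t ^ (n - 1))) * (1 - 2 * c * t + m ^ 2 * t ^ 2)
      = (c - m ^ 2 * t) * ∑' n, p n * t ^ n := by
    have s0 := (hs ht).hasSum
    have s1 := (Summable.of_norm_bounded hu fun n => hbd (n := n) ht).hasSum
    set f := ∑' n, p n * t ^ n
    set f' := ∑' n, p n * (n * t ^ (n - 1))
    have e0 := (hasSum_nat_add_iff' 1).2 s0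
    have e1 := (hasSum_nat_add_iff' 1).2 s1
    have e2 := (hasSum_nat_add_iff' 2).2 s1
    simp only [Finset.sum_range_succ, Finset.sum_range_zero, hp0, hp1, Nat.cast_zero, zero_mul,
      mul_zero, Nat.cast_one, Nat.add_sub_cancel, pow_zero, mul_one, zero_add, sub_zero,
      Nat.sub_self, add_zero] at e0 e1 e2
    have e3 := (((e2.sub (e1.mul_left (2 * c * t))).add (s1.mul_left (m ^ 2 * t ^ 2))).sub
      (e0.mul_left c)).add (s0.mul_left (m ^ 2 * t))
    have e4 := e3.unique (f := _) (a₂ := 0) (by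
      refine (hasSum_zero (α := ℝ) (β := ℕ)).congr_fun fun n => ?_
      have h := solidLegendre_add_two c (m ^ 2) n
      rw [← hpdef] at h
      -- The truncated exponent `n - 1` at `n = 0` is harmless because of the factor `n`.
      have h1 : m ^ 2 * t ^ 2 * (p n * (n * t ^ (n - 1))) = m ^ 2 * (n * p n * t ^ (n + 1)) := by
        rcases n with _ | n
        · simp
        · rw [Nat.add_sub_cancel]; ring
      rw [h1, show n + 2 - 1 = n + 1 by omega]
      push_cast
      linear_combination t ^ (n + 1) * h)
    linear_combination e4
  have hD {t : ℝ} (ht : |t| < r) : 0 < 1 - 2 * c * t + m ^ 2 * t ^ 2 := by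
    have h1 : c * t ≤ m * |t| := (le_abs_self _).trans (by rw [abs_mul]; gcongr)
    have h2 : m * |t| < 1 := lt_of_le_of_lt (by gcongr) hmr
    nlinarith [sq_abs t]
  -- By the differential equation $f\sqrt{1-2ct+m^2t^2}$ is constant, and it equals 1 at 0.
  have hg {t : ℝ} (ht : |t| < r) : HasDerivAt
      (fun t => (∑' n, p n * t ^ n) * √(1 - 2 * c * t + m ^ 2 * t ^ 2)) 0 t := by
    have h1 : HasDerivAt (fun t : ℝ => 1 - 2 * c * t + m ^ 2 * t ^ 2)
        (-(2 * c) + m ^ 2 * (2 * t)) t := by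
      have := (((hasDerivAt_id t).const_mul (2 * c)).const_sub 1).add
        ((hasDerivAt_pow 2 t).const_mul (m ^ 2))
      refine this.congr_deriv ?_
      simp
    refine ((hd ht).mul (h1.sqrt (hD ht).ne')).congr_deriv ?_
    have h2 : √(1 - 2 * c * t + m ^ 2 * t ^ 2) ≠ 0 := (Real.sqrt_pos.2 (hD ht)).ne'
    have h3 := Real.sq_sqrt (hD ht).le
    have h4 := hode ht
    apply mul_right_cancel₀ h2
    generalize √(1 - 2 * c * t + m ^ 2 * t ^ 2) = S at h2 h3
    have h5 : (-(2 * c) + m ^ 2 * (2 * t)) / (2 * S) * S = -c + m ^ 2 * t := by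
      field_simp
    linear_combination (∑' n, p n * (n * t ^ (n - 1))) * h3 + h4 + (∑' n, p n * t ^ n) * h5
  have hconst := Metric.isOpen_ball.is_const_of_deriv_eq_zero (𝕜 := ℝ)
    (convex_ball (0 : ℝ) r).isPreconnected
    (f := fun t => (∑' n, p n * t ^ n) * √(1 - 2 * c * t + m ^ 2 * t ^ 2))
    (fun t ht => (hg (by simpa using ht)).differentiableAt.differentiableWithinAt)
    (fun t ht => (hg (by simpa using ht)).deriv)
    (x := w) (y := 0) (by simpa [abs_of_nonneg hw] using hwr) (Metric.mem_ball_self hr)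
  have hwr' : |w| < r := by rwa [abs_of_nonneg hw]
  have h0 : (∑' n, p n * (0 : ℝ) ^ n) = 1 := by
    rw [tsum_eq_single 0 (fun n hn => by simp [hn])]
    simp [hp0]
  simp only [h0] at hconst
  have h1 : (∑' n, p n * w ^ n) = (√(1 - 2 * c * w + m ^ 2 * w ^ 2))⁻¹ := by
    apply eq_inv_of_mul_eq_one_left
    rw [hconst]
    simp
  rw [← h1]
  exact (hs hwr').hasSum

theorem hasSum_zonal {x y : E3} {w : ℝ} (hw : 0 ≤ w) (h : ‖x‖ * ‖y‖ * w < 1) :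
    HasSum (fun n => zonal n x y * w ^ n)
      (√(1 - 2 * inner ℝ x y * w + (‖x‖ * ‖y‖) ^ 2 * w ^ 2))⁻¹ := by
  have h1 (n : ℕ) : zonal n x y = solidLegendre (inner ℝ x y) ((‖x‖ * ‖y‖) ^ 2) n := by
    rw [zonal, mul_pow]
  simp only [h1]
  refine hasSum_solidLegendre (by positivity) (abs_real_inner_le_norm x y) (fun n => ?_) hw h
  rw [← h1, mul_pow]
  exact abs_zonal_le n x y

/-! ### Kernels $g(x)g(y)\min(a(x),a(y))$ are of positive type. -/

section MinKernel

variable {X : Type*}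

/-- The function `x ↦ g x · 𝟙[0 < z ≤ a x]`, whose products integrate over `z` to the kernel
`g x * g y * min (a x) (a y)`. -/
def levelCut (g a : X → ℝ) (x : X) (z : ℝ) : ℝ := (Set.Ioc 0 (a x)).indicator (fun _ => g x) z

theorem levelCut_mul_levelCut (g a : X → ℝ) (x y : X) :
    (fun z => levelCut g a x z * levelCut g a y z) =
      (Set.Ioc 0 (min (a x) (a y))).indicator fun _ => g x * g y := by
  ext z
  simp only [levelCut, Set.indicator, Set.mem_Ioc, le_min_iff]
  by_cases h1 : 0 < z <;> by_cases h2 : z ≤ a x <;> by_cases h3 : z ≤ a y <;> simp [h1, h2, h3]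

theorem integral_levelCut_mul_levelCut {g a : X → ℝ} (ha0 : ∀ x, 0 ≤ a x) (x y : X) :
    ∫ z, levelCut g a x z * levelCut g a y z = g x * g y * min (a x) (a y) := by
  rw [levelCut_mul_levelCut, integral_indicator_const _ measurableSet_Ioc, Real.volume_real_Ioc,
    sub_zero, max_eq_left (le_min (ha0 x) (ha0 y)), smul_eq_mul, mul_comm]

variable [MeasurableSpace X]

theorem measurable_levelCut {g a : X → ℝ} (hg : Measurable g) (ha : Measurable a) :
    Measurable fun p : X × ℝ => levelCut g a p.1 p.2 := by
  have h : (fun p : X × ℝ => levelCut g a p.1 p.2) =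
      {p : X × ℝ | 0 < p.2 ∧ p.2 ≤ a p.1}.indicator (fun p => g p.1) := by
    ext p
    simp only [levelCut, Set.indicator, Set.mem_Ioc, Set.mem_ofPred_eq]
  rw [h]
  refine (hg.comp measurable_fst).indicator ?_
  exact (measurableSet_lt measurable_const measurable_snd).inter
    (measurableSet_le measurable_snd (ha.comp measurable_fst))

/-- Layer-cake formula for the minimum, plus Fubini. For a fixed pair the integrand in `z` has
constant sign, so integrability of the kernel is exactly the absolute integrability required. -/
theorem integral_minKernel {μ ν : Measure X} [IsFiniteMeasure μ] [IsFiniteMeasure ν]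
    {g a : X → ℝ} (hg : Measurable g) (ha : Measurable a) (ha0 : ∀ x, 0 ≤ a x)
    (h : Integrable (fun p : X × X => g p.1 * g p.2 * min (a p.1) (a p.2)) (μ.prod ν)) :
    Integrable (fun z => (∫ x, levelCut g a x z ∂μ) * ∫ y, levelCut g a y z ∂ν) ∧
      ∫ p, g p.1 * g p.2 * min (a p.1) (a p.2) ∂(μ.prod ν) =
        ∫ z, (∫ x, levelCut g a x z ∂μ) * ∫ y, levelCut g a y z ∂ν := by
  have hm := measurable_levelCut hg ha
  have hi : Integrable (fun q : (X × X) × ℝ => levelCut g a q.1.1 q.2 * levelCut g a q.1.2 q.2)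
      ((μ.prod ν).prod volume) := by
    rw [integrable_prod_iff (by
      refine Measurable.aestronglyMeasurable (Measurable.mul ?_ ?_)
      · exact hm.comp ((measurable_fst.comp measurable_fst).prodMk measurable_snd)
      · exact hm.comp ((measurable_snd.comp measurable_fst).prodMk measurable_snd))]
    constructor
    · refine Filter.Eventually.of_forall fun p => ?_
      dsimp only
      rw [levelCut_mul_levelCut, integrable_indicator_iff measurableSet_Ioc]
      exact integrableOn_const (by simp)
    · refine h.norm.congr (Filter.Eventually.of_forall fun p => ?_)
      have e : (fun z => ‖levelCut g a p.1 z * levelCut g a p.2 z‖) =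
          (Set.Ioc 0 (min (a p.1) (a p.2))).indicator fun _ => ‖g p.1 * g p.2‖ := by
        ext z
        rw [congrFun (levelCut_mul_levelCut g a p.1 p.2) z, norm_indicator_eq_indicator_norm]
      dsimp only
      rw [e, integral_indicator_const _ measurableSet_Ioc, Real.volume_real_Ioc, sub_zero,
        max_eq_left (le_min (ha0 _) (ha0 _)), norm_mul _ (min _ _),
        Real.norm_of_nonneg (le_min (ha0 _) (ha0 _)), smul_eq_mul, mul_comm]
  -- The factorization holds at every level `z`, also where a factor is not integrable and its
  -- integral is 0 by convention.
  have e (z : ℝ) : ∫ p : X × X, levelCut g a p.1 z * levelCut g a p.2 z ∂(μ.prod ν) =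
      (∫ x, levelCut g a x z ∂μ) * ∫ y, levelCut g a y z ∂ν :=
    integral_prod_mul (fun x => levelCut g a x z) fun y => levelCut g a y z
  refine ⟨?_, ?_⟩
  · simpa only [e] using hi.integral_prod_right
  · simp only [← e, ← integral_levelCut_mul_levelCut ha0]
    exact integral_integral_swap hi

/-- The quadratic form of a kernel `k`, evaluated at the signed measure `μ - ν`. -/
def kernelForm (k : X → X → ℝ) (μ ν : Measure X) : ℝ :=
  ∫ p, k p.1 p.2 ∂(μ.prod μ) - 2 * ∫ p, k p.1 p.2 ∂(μ.prod ν) + ∫ p, k p.1 p.2 ∂(ν.prod ν)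

/-- At each level `z` the integrand is the square of the difference of the two level integrals. -/
theorem kernelForm_minKernel_nonneg {μ ν : Measure X} [IsFiniteMeasure μ] [IsFiniteMeasure ν]
    {g a : X → ℝ} (hg : Measurable g) (ha : Measurable a) (ha0 : ∀ x, 0 ≤ a x)
    (h1 : Integrable (fun p : X × X => g p.1 * g p.2 * min (a p.1) (a p.2)) (μ.prod μ))
    (h2 : Integrable (fun p : X × X => g p.1 * g p.2 * min (a p.1) (a p.2)) (μ.prod ν))
    (h3 : Integrable (fun p : X × X => g p.1 * g p.2 * min (a p.1) (a p.2)) (ν.prod ν)) :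
    0 ≤ kernelForm (fun x y => g x * g y * min (a x) (a y)) μ ν := by
  obtain ⟨i1, e1⟩ := integral_minKernel hg ha ha0 h1
  obtain ⟨i2, e2⟩ := integral_minKernel hg ha ha0 h2
  obtain ⟨i3, e3⟩ := integral_minKernel hg ha ha0 h3
  have e4 := integral_add (i1.sub (i2.const_mul 2)) i3
  simp only [Pi.sub_apply] at e4
  rw [kernelForm, e1, e2, e3, ← integral_const_mul, ← integral_sub i1 (i2.const_mul 2), ← e4]
  refine integral_nonneg fun z => ?_
  dsimp
  nlinarith [sq_nonneg ((∫ x, levelCut g a x z ∂μ) - ∫ y, levelCut g a y z ∂ν)]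

end MinKernel

/-! ### Positivity of the terms of degree $n\ge1$. -/

section ZonalKernel

/-- The degree `n` term in the expansion of `(|x|ˢ + |y|ˢ) / (2 |x - y|)` into zonal harmonics. -/
def zonalKernel (s : ℝ) (n : ℕ) (x y : E3) : ℝ :=
  (‖x‖ ^ s + ‖y‖ ^ s) / 2 * zonal n x y / max ‖x‖ ‖y‖ ^ (2 * n + 1)

theorem continuous_zonal (n : ℕ) : Continuous fun p : E3 × E3 => zonal n p.1 p.2 := by
  obtain ⟨S, h, hc, hz⟩ := exists_zonal_eq_sum n
  simp only [hz]
  exact continuous_finsetSum _ fun α _ =>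
    ((hc α).comp continuous_fst).mul ((hc α).comp continuous_snd)

theorem measurable_zonalKernel (s : ℝ) (n : ℕ) :
    Measurable fun p : E3 × E3 => zonalKernel s n p.1 p.2 := by
  have := (continuous_zonal n).measurable
  unfold zonalKernel
  fun_prop

theorem zonalKernel_zero (s : ℝ) (x y : E3) :
    zonalKernel s 0 x y = (‖x‖ ^ s + ‖y‖ ^ s) / 2 / max ‖x‖ ‖y‖ := by
  simp [zonalKernel, zonal, solidLegendre]

theorem zonalKernel_zero_nonneg (s : ℝ) (x y : E3) : 0 ≤ zonalKernel s 0 x y := by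
  rw [zonalKernel_zero]
  positivity

/-- Follows from the Legendre bound. Integrability of the degree 0 term thereby controls all
degrees. -/
theorem abs_zonalKernel_le (s : ℝ) (n : ℕ) (x y : E3) :
    |zonalKernel s n x y| ≤ zonalKernel s 0 x y := by
  rcases (le_max_of_le_left (norm_nonneg x) : 0 ≤ max ‖x‖ ‖y‖).eq_or_lt with h0 | hM
  · rw [zonalKernel, zonalKernel_zero, ← h0]
    simp
  · have h1 : |zonal n x y| ≤ max ‖x‖ ‖y‖ ^ (2 * n) := by
      refine (abs_zonal_le n x y).trans ?_
      rw [two_mul, pow_add]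
      gcongr
      · exact le_max_left _ _
      · exact le_max_right _ _
    rw [zonalKernel, zonalKernel_zero, abs_div, abs_mul, abs_of_nonneg (by positivity),
      abs_of_nonneg (a := max ‖x‖ ‖y‖ ^ (2 * n + 1)) (by positivity), pow_succ, ← div_div]
    refine div_le_div_of_nonneg_right ?_ (by positivity)
    rw [mul_div_assoc]
    exact mul_le_of_le_one_right (by positivity) (div_le_one_of_le₀ h1 (by positivity))

theorem integrable_zonalKernel {s : ℝ} {μ : Measure (E3 × E3)}
    (h : Integrable (fun p => zonalKernel s 0 p.1 p.2) μ) (n : ℕ) :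
    Integrable (fun p => zonalKernel s n p.1 p.2) μ :=
  h.mono' (measurable_zonalKernel s n).aestronglyMeasurable
    (Filter.Eventually.of_forall fun p => abs_zonalKernel_le s n p.1 p.2)

theorem min_rpow_neg {r t e : ℝ} (hr : 0 < r) (ht : 0 < t) (he : 0 ≤ e) :
    min (r ^ (-e)) (t ^ (-e)) = max r t ^ (-e) := by
  rcases le_total r t with h | h
  · rw [max_eq_right h, min_eq_right (Real.rpow_le_rpow_of_nonpos hr h (by linarith))]
  · rw [max_eq_left h, min_eq_left (Real.rpow_le_rpow_of_nonpos ht h (by linarith))]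

/-- With $M,m$ the maximum and minimum of $r,t$, $(M^s+m^s)M^{-b}=M^{-(b-s)}+(rt)^sM^{-(b+s)}$.
Since $b-s\ge0$, both powers of $M$ are minima of the corresponding powers of $r$ and $t$; this is
where $s\le 2n+1$ enters. -/
theorem radial_weight_eq {s r t : ℝ} {b : ℕ} (hs : 0 ≤ s) (hsb : s ≤ b) (hr : 0 < r) (ht : 0 < t) :
    (r ^ s + t ^ s) / 2 / max r t ^ b = 1 / 2 * min (r ^ (-(b - s))) (t ^ (-(b - s)))
      + 1 / 2 * (r ^ s * t ^ s * min (r ^ (-(b + s))) (t ^ (-(b + s)))) := by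
  have hM : 0 < max r t := lt_max_of_lt_left hr
  rw [min_rpow_neg hr ht (by linarith), min_rpow_neg hr ht (by positivity), neg_sub,
    Real.rpow_sub hM, Real.rpow_neg hM.le, Real.rpow_add hM, Real.rpow_natCast]
  have h1 : r ^ s * t ^ s = max r t ^ s * min r t ^ s := by
    rcases le_total r t with h | h <;> simp [h, mul_comm]
  have h2 : r ^ s + t ^ s = max r t ^ s + min r t ^ s := by
    rcases le_total r t with h | h <;> simp [h, add_comm]
  rw [h1, h2]
  have h3 : 0 < max r t ^ s := Real.rpow_pos_of_pos hM s
  field_simp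

/-- Both summands of the decomposition are nonnegative, so each is bounded by the whole. This makes
the two min-kernels integrable separately. -/
theorem mul_min_rpow_le {s r t : ℝ} {n : ℕ} (hs : 0 ≤ s) (hsn : s ≤ (2 * n + 1 : ℕ))
    (hr : 0 < r) (ht : 0 < t) :
    r ^ n * t ^ n * min (r ^ (-((2 * n + 1 : ℕ) - s))) (t ^ (-((2 * n + 1 : ℕ) - s)))
      ≤ 2 * ((r ^ s + t ^ s) / 2 / max r t) ∧
    (r ^ s * r ^ n) * (t ^ s * t ^ n) *
      min (r ^ (-((2 * n + 1 : ℕ) + s))) (t ^ (-((2 * n + 1 : ℕ) + s)))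
      ≤ 2 * ((r ^ s + t ^ s) / 2 / max r t) := by
  have hM : 0 < max r t := lt_max_of_lt_left hr
  have h1 := radial_weight_eq hs hsn hr ht
  have h2 : 0 ≤ min (r ^ (-((2 * n + 1 : ℕ) - s))) (t ^ (-((2 * n + 1 : ℕ) - s))) := by positivity
  have h3 : 0 ≤ min (r ^ (-((2 * n + 1 : ℕ) + s))) (t ^ (-((2 * n + 1 : ℕ) + s))) := by positivity
  set A := min (r ^ (-((2 * n + 1 : ℕ) - s))) (t ^ (-((2 * n + 1 : ℕ) - s)))
  set B := min (r ^ (-((2 * n + 1 : ℕ) + s))) (t ^ (-((2 * n + 1 : ℕ) + s)))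
  have h4 : r ^ n * t ^ n ≤ max r t ^ (2 * n) := by
    rw [two_mul, pow_add]
    gcongr
    · exact le_max_left _ _
    · exact le_max_right _ _
  have h5 : r ^ n * t ^ n * ((r ^ s + t ^ s) / 2 / max r t ^ (2 * n + 1))
      ≤ (r ^ s + t ^ s) / 2 / max r t := by
    calc _ ≤ max r t ^ (2 * n) * ((r ^ s + t ^ s) / 2 / max r t ^ (2 * n + 1)) := by gcongr
      _ = _ := by rw [pow_succ]; field_simp
  rw [h1] at h5
  have h6 : 0 ≤ r ^ n * t ^ n * A := by positivity
  have h7 : 0 ≤ r ^ n * t ^ n * (r ^ s * t ^ s * B) := by positivity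
  constructor <;> nlinarith

/-- For `s ≤ 2 n + 1` the degree `n ≥ 1` term of the expansion is of positive type. -/
theorem kernelForm_zonalKernel_nonneg {s : ℝ} {n : ℕ} (hn : n ≠ 0) (hs : 0 ≤ s)
    (hsn : s ≤ 2 * n + 1) {μ ν : Measure E3} [IsFiniteMeasure μ] [IsFiniteMeasure ν]
    (h1 : Integrable (fun p => zonalKernel s 0 p.1 p.2) (μ.prod μ))
    (h2 : Integrable (fun p => zonalKernel s 0 p.1 p.2) (μ.prod ν))
    (h3 : Integrable (fun p => zonalKernel s 0 p.1 p.2) (ν.prod ν)) :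
    0 ≤ kernelForm (zonalKernel s n) μ ν := by
  obtain ⟨S, h, hc, hz⟩ := exists_zonal_eq_sum n
  have hsn' : s ≤ (2 * n + 1 : ℕ) := by push_cast; exact hsn
  set a₁ : E3 → ℝ := fun x => ‖x‖ ^ (-((2 * n + 1 : ℕ) - s)) with ha₁
  set a₂ : E3 → ℝ := fun x => ‖x‖ ^ (-((2 * n + 1 : ℕ) + s)) with ha₂
  set f : (Fin 3 →₀ ℕ) → E3 → E3 → ℝ := fun α x y => h α x * h α y * min (a₁ x) (a₁ y)
  set k : (Fin 3 →₀ ℕ) → E3 → E3 → ℝ := fun α x y =>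
    (‖x‖ ^ s * h α x) * (‖y‖ ^ s * h α y) * min (a₂ x) (a₂ y)
  have hm₁ : Measurable a₁ := by fun_prop
  have hm₂ : Measurable a₂ := by fun_prop
  have hmh (α : Fin 3 →₀ ℕ) : Measurable (h α) := (hc α).measurable
  have hmh' (α : Fin 3 →₀ ℕ) : Measurable fun x => ‖x‖ ^ s * h α x := by fun_prop
  -- The square of `h α x` is one of the nonnegative summands of `zonal n x x`.
  have hle (α : Fin 3 →₀ ℕ) (hα : α ∈ S) (x : E3) : |h α x| ≤ ‖x‖ ^ n := by
    apply abs_le_of_sq_le_sq _ (by positivity)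
    rw [← pow_mul, mul_comm n, ← zonal_self, hz, pow_two]
    exact Finset.single_le_sum (f := fun α => h α x * h α x)
      (fun α _ => mul_self_nonneg _) hα
  -- For `n ≠ 0` this vanishing makes the values of negative powers at the origin irrelevant.
  have h0 (α : Fin 3 →₀ ℕ) (hα : α ∈ S) : h α 0 = 0 := by
    simpa [hn] using hle α hα 0
  have hf (α : Fin 3 →₀ ℕ) (hα : α ∈ S) (x y : E3) :
      ‖f α x y‖ ≤ 2 * zonalKernel s 0 x y ∧ ‖k α x y‖ ≤ 2 * zonalKernel s 0 x y := by
    have hnn := zonalKernel_zero_nonneg s x y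
    by_cases hx : x = 0
    · simp only [f, k, hx, h0 α hα] at hnn ⊢; simp [hnn]
    by_cases hy : y = 0
    · simp only [f, k, hy, h0 α hα] at hnn ⊢; simp [hnn]
    replace hx := norm_pos_iff.2 hx
    replace hy := norm_pos_iff.2 hy
    have hb := mul_min_rpow_le hs hsn' hx hy
    rw [zonalKernel_zero]
    constructor
    · refine le_trans ?_ hb.1
      simp only [f, ha₁]
      rw [norm_mul, norm_mul, Real.norm_of_nonneg (r := min _ _) (by positivity), Real.norm_eq_abs,
        Real.norm_eq_abs]
      gcongr
      · exact hle α hα x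
      · exact hle α hα y
    · refine le_trans ?_ hb.2
      simp only [k, ha₂]
      rw [norm_mul, norm_mul, Real.norm_of_nonneg (r := min _ _) (by positivity), norm_mul,
        norm_mul, Real.norm_eq_abs (h α x), Real.norm_eq_abs (h α y), Real.norm_of_nonneg
        (r := ‖x‖ ^ s) (by positivity), Real.norm_of_nonneg (r := ‖y‖ ^ s) (by positivity)]
      gcongr
      · exact hle α hα x
      · exact hle α hα y
  have hif (α : Fin 3 →₀ ℕ) (hα : α ∈ S) {ξ : Measure (E3 × E3)}
      (hξ : Integrable (fun p => zonalKernel s 0 p.1 p.2) ξ) :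
      Integrable (fun p => f α p.1 p.2) ξ ∧ Integrable (fun p => k α p.1 p.2) ξ := by
    constructor
    · refine (hξ.const_mul 2).mono' (Measurable.aestronglyMeasurable ?_)
        (Filter.Eventually.of_forall fun p => (hf α hα p.1 p.2).1)
      have := hmh α
      simp only [f]
      fun_prop
    · refine (hξ.const_mul 2).mono' (Measurable.aestronglyMeasurable ?_)
        (Filter.Eventually.of_forall fun p => (hf α hα p.1 p.2).2)
      have := hmh α
      simp only [k]
      fun_prop
  have hsum (x y : E3) : zonalKernel s n x y = ∑ α ∈ S, (1 / 2 * f α x y + 1 / 2 * k α x y) := by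
    by_cases hx : x = 0
    · have e : zonal n 0 y = 0 := by
        rw [hz]; exact Finset.sum_eq_zero fun α hα => by rw [h0 α hα, zero_mul]
      rw [hx, zonalKernel, e, mul_zero, zero_div]
      exact (Finset.sum_eq_zero fun α hα => by simp [f, k, h0 α hα]).symm
    by_cases hy : y = 0
    · have e : zonal n x 0 = 0 := by
        rw [hz]; exact Finset.sum_eq_zero fun α hα => by rw [h0 α hα, mul_zero]
      rw [hy, zonalKernel, e, mul_zero, zero_div]
      exact (Finset.sum_eq_zero fun α hα => by simp [f, k, h0 α hα]).symm
    replace hx := norm_pos_iff.2 hx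
    replace hy := norm_pos_iff.2 hy
    rw [zonalKernel, mul_div_right_comm, radial_weight_eq hs hsn' hx hy, hz, Finset.mul_sum]
    refine Finset.sum_congr rfl fun α _ => ?_
    simp only [f, k, ha₁, ha₂]
    ring
  have hint {ξ : Measure (E3 × E3)} (hξ : Integrable (fun p => zonalKernel s 0 p.1 p.2) ξ) :
      ∫ p, zonalKernel s n p.1 p.2 ∂ξ =
        ∑ α ∈ S, (1 / 2 * ∫ p, f α p.1 p.2 ∂ξ + 1 / 2 * ∫ p, k α p.1 p.2 ∂ξ) := by
    simp only [hsum]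
    have hadd (α : Fin 3 →₀ ℕ) (hα : α ∈ S) :
        Integrable (fun p => 1 / 2 * f α p.1 p.2 + 1 / 2 * k α p.1 p.2) ξ :=
      ((hif α hα hξ).1.const_mul (1 / 2)).add ((hif α hα hξ).2.const_mul (1 / 2))
    rw [integral_finsetSum S hadd]
    refine Finset.sum_congr rfl fun α hα => ?_
    rw [integral_add ((hif α hα hξ).1.const_mul (1 / 2)) ((hif α hα hξ).2.const_mul (1 / 2)),
      integral_const_mul, integral_const_mul]
  have hform : kernelForm (zonalKernel s n) μ ν =
      ∑ α ∈ S, (1 / 2 * kernelForm (f α) μ ν + 1 / 2 * kernelForm (k α) μ ν) := by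
    simp only [kernelForm]
    rw [hint h1, hint h2, hint h3, Finset.mul_sum, ← Finset.sum_sub_distrib,
      ← Finset.sum_add_distrib]
    exact Finset.sum_congr rfl fun α _ => by ring
  rw [hform]
  refine Finset.sum_nonneg fun α hα => ?_
  have p₁ : 0 ≤ kernelForm (f α) μ ν := kernelForm_minKernel_nonneg (hmh α) hm₁
    (fun x => by positivity) (hif α hα h1).1 (hif α hα h2).1 (hif α hα h3).1
  have p₂ : 0 ≤ kernelForm (k α) μ ν := kernelForm_minKernel_nonneg (hmh' α) hm₂
    (fun x => by positivity) (hif α hα h1).2 (hif α hα h2).2 (hif α hα h3).2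
  positivity

end ZonalKernel

/-! ### Invariance of the radial part and comparison of the expansion terms. -/

section Rotations

theorem SO3.rotate_mul (U V : SO3) (x : E3) :
    SO3.rotate (U * V) x = SO3.rotate U (SO3.rotate V x) := by
  simp [SO3.rotate, Matrix.mulVec_mulVec]

theorem SO3.rotate_one (x : E3) : SO3.rotate 1 x = x := by
  simp [SO3.rotate]

theorem SO3.inner_rotate (U : SO3) (x y : E3) :
    inner ℝ (SO3.rotate U x) (SO3.rotate U y) = inner ℝ x y := by
  have h : star (U : Matrix (Fin 3) (Fin 3) ℝ) * (U : Matrix (Fin 3) (Fin 3) ℝ) = 1 := by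
    rw [← SO3.coe_inv]
    exact congrArg Subtype.val (inv_mul_cancel U)
  rw [Matrix.star_eq_conjTranspose, Matrix.conjTranspose_eq_transpose_of_trivial] at h
  rw [EuclideanSpace.inner_eq_star_dotProduct, EuclideanSpace.inner_eq_star_dotProduct]
  simp only [SO3.rotate, star_trivial]
  rw [Matrix.dotProduct_mulVec, ← Matrix.mulVec_transpose, Matrix.mulVec_mulVec, h,
    Matrix.one_mulVec]

theorem SO3.norm_rotate (U : SO3) (x : E3) : ‖SO3.rotate U x‖ = ‖x‖ := by
  rw [norm_eq_sqrt_real_inner, SO3.inner_rotate, ← norm_eq_sqrt_real_inner]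

/-- A rotation as a linear isometry. -/
def SO3.rotateIsometry (U : SO3) : E3 ≃ₗᵢ[ℝ] E3 where
  toFun := SO3.rotate U
  invFun := SO3.rotate U⁻¹
  map_add' x y := by simp [SO3.rotate, Matrix.mulVec_add]
  map_smul' c x := by simp [SO3.rotate, Matrix.mulVec_smul]
  left_inv x := by rw [← SO3.rotate_mul, inv_mul_cancel, SO3.rotate_one]
  right_inv x := by rw [← SO3.rotate_mul, mul_inv_cancel, SO3.rotate_one]
  norm_map' := SO3.norm_rotate U

theorem SO3.continuous_rotate (U : SO3) : Continuous (SO3.rotate U) :=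
  U.rotateIsometry.continuous

instance SO3.instIsHaarMeasureHaar : SO3.haar.IsHaarMeasure :=
  inferInstanceAs (Measure.haarMeasure ⊤).IsHaarMeasure

/-- A right translate of Haar measure is again a Haar probability measure, and that is unique. -/
theorem SO3.map_mul_right_haar (V : SO3) : SO3.haar.map (· * V) = SO3.haar := by
  have h1 : (SO3.haar.map (· * V)).IsHaarMeasure := Measure.isHaarMeasure_map_mul_right _ V
  have h2 : IsProbabilityMeasure (SO3.haar.map (· * V)) :=
    Measure.isProbabilityMeasure_map (measurable_mul_const V).aemeasurable
  exact Measure.isHaarMeasure_eq_of_isProbabilityMeasure _ _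

theorem SO3.lintegral_mul_right_haar (V : SO3) {f : SO3 → ℝ≥0∞} (hf : Measurable f) :
    ∫⁻ U, f (U * V) ∂SO3.haar = ∫⁻ U, f U ∂SO3.haar := by
  rw [← lintegral_map hf (measurable_mul_const V), SO3.map_mul_right_haar]

/-- Since $VU^{-1}=(UV^{-1})^{-1}$, the rotation is absorbed by a right translation of $U$. -/
theorem map_rotate_radialPart (ρ : ProbabilityMeasure E3) (V : SO3) :
    (radialPart ρ : Measure E3).map (SO3.rotate V) = radialPart ρ := by
  refine Measure.ext_of_lintegral _ fun f hf => ?_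
  have hV : Measurable (SO3.rotate V) := (SO3.continuous_rotate V).measurable
  rw [lintegral_map hf hV, lintegral_radialPart ρ (f := fun x => f (SO3.rotate V x)) (hf.comp hV), lintegral_radialPart ρ hf]
  refine lintegral_congr fun x => ?_
  have hm : Measurable fun U : SO3 => f (SO3.rotate U⁻¹ x) :=
    hf.comp (SO3.measurable_rotateInv.comp measurable_prodMk_right)
  rw [← SO3.lintegral_mul_right_haar V⁻¹ hm]
  refine lintegral_congr fun U => ?_
  rw [mul_inv_rev, inv_inv, SO3.rotate_mul]

theorem lintegral_rotate_radialPart (ρ : ProbabilityMeasure E3) (V : SO3) {f : E3 → ℝ≥0∞}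
    (hf : Measurable f) :
    ∫⁻ x, f (SO3.rotate V x) ∂(radialPart ρ : Measure E3) =
      ∫⁻ x, f x ∂(radialPart ρ : Measure E3) := by
  conv_rhs => rw [← map_rotate_radialPart ρ V,
    lintegral_map hf (SO3.continuous_rotate V).measurable]

theorem isRadial_radialPart (ρ : ProbabilityMeasure E3) : IsRadial (radialPart ρ) := by
  refine Subtype.ext (Measure.ext_of_lintegral _ fun f hf => ?_)
  change _ = ∫⁻ x, f x ∂(radialPart (radialPart ρ) : Measure E3)
  rw [lintegral_radialPart (radialPart ρ) hf, lintegral_lintegral_swap]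
  · simp only [lintegral_rotate_radialPart ρ _ hf, lintegral_const, measure_univ, mul_one]
    rfl
  · exact ((hf.comp SO3.measurable_rotateInv).comp measurable_swap).aemeasurable

theorem map_norm_radialPart (ρ : ProbabilityMeasure E3) :
    (radialPart ρ : Measure E3).map norm = (ρ : Measure E3).map norm := by
  refine Measure.ext_of_lintegral _ fun f hf => ?_
  rw [lintegral_map hf measurable_norm, lintegral_map hf measurable_norm,
    lintegral_radialPart ρ (f := fun x => f ‖x‖) (hf.comp measurable_norm)]
  simp [SO3.norm_rotate]

theorem absMoment_radialPart (t : ℝ) (ρ : ProbabilityMeasure E3) :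
    absMoment t (radialPart ρ) = absMoment t ρ := by
  have h : Measurable fun x : E3 => ENNReal.ofReal (‖x‖ ^ t) := by fun_prop
  rw [absMoment, absMoment, lintegral_radialPart ρ h]
  simp [SO3.norm_rotate]

/-- With `ρ̄` the radial part of `ρ`, there is a coupling of `ρ̄ ⊗ ρ̄` and `ρ ⊗ ρ̄` whose two pairs
of points differ by a rotation. -/
theorem exists_coupling_radialPart (ρ : ProbabilityMeasure E3) :
    ∃ (ξ : Measure ((SO3 × E3) × E3)) (Φ Ψ : (SO3 × E3) × E3 → E3 × E3),
      Measurable Φ ∧ Measurable Ψ ∧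
      ξ.map Φ = (radialPart ρ : Measure E3).prod (radialPart ρ : Measure E3) ∧
      ξ.map Ψ = (ρ : Measure E3).prod (radialPart ρ : Measure E3) ∧
      ∀ q, ∃ U : SO3, Ψ q = (SO3.rotate U (Φ q).1, SO3.rotate U (Φ q).2) := by
  have hΨ : Measurable fun q : (SO3 × E3) × E3 => (q.1.2, SO3.rotate q.1.1 q.2) := by
    have h : (fun q : (SO3 × E3) × E3 => SO3.rotate q.1.1 q.2) =
        SO3.rotateInv ∘ fun q => (q.1.1⁻¹, q.2) := by
      ext1 q
      simp [SO3.rotateInv]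
    have h' : Measurable fun q : (SO3 × E3) × E3 => SO3.rotate q.1.1 q.2 := by
      rw [h]
      exact SO3.measurable_rotateInv.comp
        ((measurable_inv.comp (measurable_fst.comp measurable_fst)).prodMk measurable_snd)
    exact (measurable_snd.comp measurable_fst).prodMk h'
  -- Draw $U$ from Haar measure, $x$ from $\rho$ and $y$ from $\overline\rho$ independently; the
  -- pairs are $(U^{-1}x,y)$ and $(x,Uy)$. The law of the second follows from the invariance of
  -- $\overline\rho$.
  refine ⟨(SO3.haar.prod (ρ : Measure E3)).prod (radialPart ρ : Measure E3),
    Prod.map SO3.rotateInv id, fun q => (q.1.2, SO3.rotate q.1.1 q.2),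
    SO3.measurable_rotateInv.prodMap measurable_id, hΨ, ?_, ?_, fun q => ⟨q.1.1, ?_⟩⟩
  · rw [← Measure.map_prod_map _ _ SO3.measurable_rotateInv measurable_id, Measure.map_id]
    rfl
  · refine Measure.ext_of_lintegral _ fun f hf => ?_
    rw [lintegral_map hf hΨ, lintegral_prod (fun q : (SO3 × E3) × E3 => f (q.1.2, SO3.rotate q.1.1 q.2))
        (hf.comp hΨ).aemeasurable,
      lintegral_prod _ hf.aemeasurable]
    have h1 (p : SO3 × E3) : ∫⁻ y, f (p.2, SO3.rotate p.1 y) ∂(radialPart ρ : Measure E3) =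
        ∫⁻ y, f (p.2, y) ∂(radialPart ρ : Measure E3) :=
      lintegral_rotate_radialPart ρ p.1 (f := fun y => f (p.2, y)) (hf.comp measurable_prodMk_left)
    simp only [h1]
    have h2 : Measurable fun x : E3 => ∫⁻ y, f (x, y) ∂(radialPart ρ : Measure E3) :=
      hf.lintegral_prod_right'
    rw [lintegral_prod (fun p : SO3 × E3 => ∫⁻ y, f (p.2, y) ∂(radialPart ρ : Measure E3))
      (h2.comp measurable_snd).aemeasurable]
    simp
  · simp [SO3.rotateInv, ← SO3.rotate_mul, SO3.rotate_one]

theorem integral_prod_radialPart_eq {ρ : ProbabilityMeasure E3} {k : E3 → E3 → ℝ}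
    (hk : Measurable fun p : E3 × E3 => k p.1 p.2)
    (hU : ∀ (U : SO3) x y, k (SO3.rotate U x) (SO3.rotate U y) = k x y) :
    ∫ p, k p.1 p.2 ∂((ρ : Measure E3).prod (radialPart ρ : Measure E3)) =
      ∫ p, k p.1 p.2 ∂((radialPart ρ : Measure E3).prod (radialPart ρ : Measure E3)) := by
  obtain ⟨ξ, Φ, Ψ, hΦ, hΨ, e1, e2, h⟩ := exists_coupling_radialPart ρ
  rw [← e1, ← e2, integral_map hΦ.aemeasurable hk.aestronglyMeasurable,
    integral_map hΨ.aemeasurable hk.aestronglyMeasurable]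
  congr 1 with q
  obtain ⟨U, hq⟩ := h q
  rw [hq, hU]

theorem zonalKernel_rotate (s : ℝ) (n : ℕ) (U : SO3) (x y : E3) :
    zonalKernel s n (SO3.rotate U x) (SO3.rotate U y) = zonalKernel s n x y := by
  simp [zonalKernel, zonal, SO3.norm_rotate, SO3.inner_rotate]

/-- A function of the norms has the same law under measures with the same norm distribution. -/
theorem integrable_and_integral_eq_of_map_norm_eq {μ ν μ' ν' : Measure E3} [SFinite μ] [SFinite ν]
    [SFinite μ'] [SFinite ν'] (h1 : μ.map norm = μ'.map norm) (h2 : ν.map norm = ν'.map norm)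
    {k : ℝ × ℝ → ℝ} (hk : Measurable k) :
    (Integrable (fun p : E3 × E3 => k (‖p.1‖, ‖p.2‖)) (μ.prod ν) ↔
      Integrable (fun p : E3 × E3 => k (‖p.1‖, ‖p.2‖)) (μ'.prod ν')) ∧
    ∫ p : E3 × E3, k (‖p.1‖, ‖p.2‖) ∂(μ.prod ν) = ∫ p : E3 × E3, k (‖p.1‖, ‖p.2‖) ∂(μ'.prod ν') := by
  have hn : Measurable (Prod.map norm norm : E3 × E3 → ℝ × ℝ) :=
    measurable_norm.prodMap measurable_norm
  have e : (μ.prod ν).map (Prod.map norm norm) = (μ'.prod ν').map (Prod.map norm norm) := by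
    rw [← Measure.map_prod_map _ _ measurable_norm measurable_norm,
      ← Measure.map_prod_map _ _ measurable_norm measurable_norm, h1, h2]
  constructor
  · have a := integrable_map_measure (μ := μ.prod ν) hk.aestronglyMeasurable hn.aemeasurable
    have b := integrable_map_measure (μ := μ'.prod ν') hk.aestronglyMeasurable hn.aemeasurable
    rw [e] at a
    exact a.symm.trans b
  · have a := integral_map (μ := μ.prod ν) hn.aemeasurable
      (hk.aestronglyMeasurable (μ := (μ.prod ν).map (Prod.map norm norm)))
    have b := integral_map (μ := μ'.prod ν') hn.aemeasurable
      (hk.aestronglyMeasurable (μ := (μ'.prod ν').map (Prod.map norm norm)))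
    rw [e] at a
    exact a.symm.trans b

/-- Degree 0 sees only the norms, whose law is unchanged. In degree $n\ge1$ the form at
$\rho-\overline\rho$ is nonnegative, and its cross term collapses to the
$\overline\rho\otimes\overline\rho$ integral. -/
theorem integral_zonalKernel_radialPart_le {s : ℝ} (hs : 1 ≤ s) (hs₃ : s ≤ 3)
    {ρ : ProbabilityMeasure E3}
    (h : Integrable (fun p => zonalKernel s 0 p.1 p.2) ((ρ : Measure E3).prod (ρ : Measure E3))) :
    Integrable (fun p => zonalKernel s 0 p.1 p.2)
      ((radialPart ρ : Measure E3).prod (radialPart ρ : Measure E3)) ∧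
    ∀ n, ∫ p, zonalKernel s n p.1 p.2 ∂((radialPart ρ : Measure E3).prod (radialPart ρ : Measure E3))
      ≤ ∫ p, zonalKernel s n p.1 p.2 ∂((ρ : Measure E3).prod (ρ : Measure E3)) := by
  have hk : Measurable fun q : ℝ × ℝ => (q.1 ^ s + q.2 ^ s) / 2 / max q.1 q.2 := by fun_prop
  have h0 (p : E3 × E3) : zonalKernel s 0 p.1 p.2 =
      (fun q : ℝ × ℝ => (q.1 ^ s + q.2 ^ s) / 2 / max q.1 q.2) (‖p.1‖, ‖p.2‖) :=
    zonalKernel_zero s p.1 p.2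
  have hn := map_norm_radialPart ρ
  have a := integrable_and_integral_eq_of_map_norm_eq hn hn hk
  have b := integrable_and_integral_eq_of_map_norm_eq
    (rfl : (ρ : Measure E3).map norm = (ρ : Measure E3).map norm) hn hk
  simp only [← h0] at a b
  have h3 := a.1.2 h
  refine ⟨h3, fun n => ?_⟩
  rcases eq_or_ne n 0 with rfl | hn0
  · exact a.2.le
  · have hn1 : (1 : ℝ) ≤ n := by exact_mod_cast Nat.one_le_iff_ne_zero.2 hn0
    have := kernelForm_zonalKernel_nonneg hn0 (by linarith) (by linarith) h (b.1.2 h) h3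
    rw [kernelForm, integral_prod_radialPart_eq (measurable_zonalKernel s n)
      (zonalKernel_rotate s n)] at this
    linarith

end Rotations

/-! ### Abel summation of the expansion and the limit $\eta\to1$. -/

section Regularization

open Filter Topology

/-- The distance `|X - η Y|` between the longer one `X` of `x`, `y` and `η` times the
shorter one `Y`. -/
def regDist (η : ℝ) (x y : E3) : ℝ :=
  √(max ‖x‖ ‖y‖ ^ 2 - 2 * η * inner ℝ x y + η ^ 2 * min ‖x‖ ‖y‖ ^ 2)

/-- The energy kernel with the distance replaced by the regularized one. -/
def regKernel (s η : ℝ) (x y : E3) : ℝ := (‖x‖ ^ s + ‖y‖ ^ s) / (2 * regDist η x y)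

theorem norm_sub_eq_regDist (x y : E3) : ‖x - y‖ = regDist 1 x y := by
  have h : max ‖x‖ ‖y‖ ^ 2 + min ‖x‖ ‖y‖ ^ 2 = ‖x‖ ^ 2 + ‖y‖ ^ 2 := by
    rcases le_total ‖x‖ ‖y‖ with h | h <;> simp [h, add_comm]
  rw [regDist, ← Real.sqrt_sq (norm_nonneg (x - y)), norm_sub_sq_real]
  congr 1
  linear_combination -h

theorem continuous_regDist (η : ℝ) : Continuous fun p : E3 × E3 => regDist η p.1 p.2 := by
  unfold regDist
  fun_prop

theorem continuous_regDist_left (x y : E3) : Continuous fun η => regDist η x y := by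
  unfold regDist
  fun_prop

theorem regDist_nonneg (η : ℝ) (x y : E3) : 0 ≤ regDist η x y := Real.sqrt_nonneg _

theorem inner_le_max_mul_min (x y : E3) : inner ℝ x y ≤ max ‖x‖ ‖y‖ * min ‖x‖ ‖y‖ := by
  rw [max_mul_min]
  exact real_inner_le_norm x y

/-- Supplies the dominating function, uniform in `η`, for the limit. -/
theorem norm_sub_le_two_mul_regDist {η : ℝ} (h1 : 1 / 2 ≤ η) (h2 : η ≤ 1) (x y : E3) :
    ‖x - y‖ ≤ 2 * regDist η x y := by
  have hm : 0 ≤ min ‖x‖ ‖y‖ := by positivity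
  have hmM : min ‖x‖ ‖y‖ ≤ max ‖x‖ ‖y‖ := min_le_max
  have hc := inner_le_max_mul_min x y
  have h4 : (2 : ℝ) = √(2 ^ 2) := by simp
  rw [norm_sub_eq_regDist, regDist, regDist, h4, ← Real.sqrt_mul (by norm_num)]
  apply Real.sqrt_le_sqrt
  rw [← h4]
  set M := max ‖x‖ ‖y‖
  set m := min ‖x‖ ‖y‖
  -- After the inner product is replaced by its upper bound $Mm$, the difference of the two squared
  -- sides factors in this way.
  have h5 : 0 ≤ (M + m - 2 * η * m) * (3 * M - m - 2 * η * m) :=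
    mul_nonneg (by nlinarith) (by nlinarith)
  nlinarith [mul_nonneg (by linarith : 0 ≤ 8 * η - 2) (sub_nonneg.2 hc)]

/-- The generating function at $w=\eta/\max(|x|,|y|)^2$. The factor $\eta<1$ keeps $|x||y|w<1$ even
when the norms coincide. -/
theorem hasSum_zonalKernel (s : ℝ) {η : ℝ} (h0 : 0 ≤ η) (h1 : η < 1) (x y : E3) :
    HasSum (fun n => η ^ n * zonalKernel s n x y) (regKernel s η x y) := by
  rcases (le_max_of_le_left (norm_nonneg x) : 0 ≤ max ‖x‖ ‖y‖).eq_or_lt with hM | hM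
  · have hx : x = 0 := norm_le_zero_iff.1 (hM ▸ le_max_left _ _)
    have hy : y = 0 := norm_le_zero_iff.1 (hM ▸ le_max_right _ _)
    simp [zonalKernel, regKernel, regDist, hx, hy]
  · have hmM : min ‖x‖ ‖y‖ ≤ max ‖x‖ ‖y‖ := min_le_max
    have hm : 0 ≤ min ‖x‖ ‖y‖ := by positivity
    have hw : 0 ≤ η / max ‖x‖ ‖y‖ ^ 2 := by positivity
    have hprod : ‖x‖ * ‖y‖ * (η / max ‖x‖ ‖y‖ ^ 2) < 1 := by
      rw [← max_mul_min ‖x‖ ‖y‖, mul_div_assoc', div_lt_one (by positivity)]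
      nlinarith [mul_le_mul_of_nonneg_left hmM hM.le, mul_pos hM hM]
    have h := (hasSum_zonal hw hprod).mul_left ((‖x‖ ^ s + ‖y‖ ^ s) / (2 * max ‖x‖ ‖y‖))
    have e : regDist η x y = max ‖x‖ ‖y‖ * √(1 - 2 * inner ℝ x y * (η / max ‖x‖ ‖y‖ ^ 2)
        + (‖x‖ * ‖y‖) ^ 2 * (η / max ‖x‖ ‖y‖ ^ 2) ^ 2) := by
      rw [regDist, ← Real.sqrt_sq hM.le, ← Real.sqrt_mul (by positivity), Real.sqrt_sq hM.le,
        ← max_mul_min ‖x‖ ‖y‖]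
      congr 1
      field_simp
    rw [regKernel, e, ← mul_assoc, ← div_div, div_eq_mul_inv _ (√_)]
    refine h.congr_fun fun n => ?_
    rw [zonalKernel, div_pow, ← pow_mul, pow_succ]
    field_simp

theorem measurable_regKernel (s η : ℝ) : Measurable fun p : E3 × E3 => regKernel s η p.1 p.2 := by
  have := (continuous_regDist η).measurable
  unfold regKernel
  fun_prop

theorem regKernel_nonneg (s η : ℝ) (x y : E3) : 0 ≤ regKernel s η x y := by
  have := regDist_nonneg η x y
  unfold regKernel
  positivity

section

variable {s η : ℝ} (h0 : 0 ≤ η) (h1 : η < 1) {ξ : Measure (E3 × E3)}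
  (h : Integrable (fun p => zonalKernel s 0 p.1 p.2) ξ)
include h0 h1 h

theorem integrable_regKernel : Integrable (fun p => regKernel s η p.1 p.2) ξ := by
  refine (h.const_mul (1 - η)⁻¹).mono' (measurable_regKernel s η).aestronglyMeasurable
    (Eventually.of_forall fun p => ?_)
  have hs := (hasSum_geometric_of_lt_one h0 h1).mul_right (zonalKernel s 0 p.1 p.2)
  rw [← (hasSum_zonalKernel s h0 h1 p.1 p.2).tsum_eq]
  refine tsum_of_norm_bounded hs fun n => ?_
  rw [norm_mul, norm_pow, Real.norm_of_nonneg h0]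
  gcongr
  exact abs_zonalKernel_le s n p.1 p.2

theorem hasSum_integral_zonalKernel :
    HasSum (fun n => η ^ n * ∫ p, zonalKernel s n p.1 p.2 ∂ξ)
      (∫ p, regKernel s η p.1 p.2 ∂ξ) := by
  have hi (n : ℕ) := (integrable_zonalKernel h n).const_mul (η ^ n)
  have hsum : Summable fun n => ∫ p, ‖η ^ n * zonalKernel s n p.1 p.2‖ ∂ξ := by
    refine Summable.of_nonneg_of_le (fun n => integral_nonneg fun p => norm_nonneg _) (fun n => ?_)
      ((summable_geometric_of_lt_one h0 h1).mul_right (∫ p, zonalKernel s 0 p.1 p.2 ∂ξ))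
    rw [← integral_const_mul]
    refine integral_mono (hi n).norm (h.const_mul _) fun p => ?_
    dsimp only
    rw [norm_mul, norm_pow, Real.norm_of_nonneg h0]
    gcongr
    exact abs_zonalKernel_le s n p.1 p.2
  have := hasSum_integral_of_summable_integral_norm hi hsum
  simpa only [integral_const_mul, (hasSum_zonalKernel s h0 h1 _ _).tsum_eq] using this

end

theorem integral_regKernel_radialPart_le {s η : ℝ} (hs : 1 ≤ s) (hs₃ : s ≤ 3) (h0 : 0 ≤ η)
    (h1 : η < 1) {ρ : ProbabilityMeasure E3}
    (h : Integrable (fun p => zonalKernel s 0 p.1 p.2) ((ρ : Measure E3).prod (ρ : Measure E3))) :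
    ∫ p, regKernel s η p.1 p.2 ∂((radialPart ρ : Measure E3).prod (radialPart ρ : Measure E3))
      ≤ ∫ p, regKernel s η p.1 p.2 ∂((ρ : Measure E3).prod (ρ : Measure E3)) := by
  obtain ⟨h2, h3⟩ := integral_zonalKernel_radialPart_le hs hs₃ h
  exact hasSum_le (fun n => mul_le_mul_of_nonneg_left (h3 n) (by positivity))
    (hasSum_integral_zonalKernel h0 h1 h2) (hasSum_integral_zonalKernel h0 h1 h)

/-- The `[0, ∞]`-valued energy kernel with a general distance. -/
def energyKernel (s : ℝ) (d : E3 → E3 → ℝ) (p : E3 × E3) : ℝ≥0∞ :=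
  ENNReal.ofReal (‖p.1‖ ^ s + ‖p.2‖ ^ s) / ENNReal.ofReal (2 * d p.1 p.2)

theorem measurable_energyKernel_regDist (s η : ℝ) : Measurable (energyKernel s (regDist η)) := by
  have := (continuous_regDist η).measurable
  unfold energyKernel
  fun_prop

theorem weightedEnergy_eq (s : ℝ) (ρ : ProbabilityMeasure E3) : weightedEnergy s ρ =
    ∫⁻ p, energyKernel s (regDist 1) p ∂((ρ : Measure E3).prod (ρ : Measure E3)) := by
  rw [lintegral_prod _ (measurable_energyKernel_regDist s 1).aemeasurable, weightedEnergy]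
  simp only [energyKernel, norm_sub_eq_regDist]

theorem ofReal_regKernel {s η : ℝ} (hs : 0 < s) (h1 : 1 / 2 ≤ η) (h2 : η < 1) (p : E3 × E3) :
    ENNReal.ofReal (regKernel s η p.1 p.2) = energyKernel s (regDist η) p := by
  -- For $\eta<1$ the regularized distance is at least $M-\eta m$ and vanishes only at the origin.
  -- There both numerators are zero and both conventions for $0/0$ give 0.
  rcases (regDist_nonneg η p.1 p.2).eq_or_lt with h | h
  · have hM : max ‖p.1‖ ‖p.2‖ = 0 := by
      by_contra hne
      have hM : 0 < max ‖p.1‖ ‖p.2‖ := lt_of_le_of_ne (by positivity) (Ne.symm hne)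
      have hm : 0 ≤ min ‖p.1‖ ‖p.2‖ := by positivity
      have hmM : min ‖p.1‖ ‖p.2‖ ≤ max ‖p.1‖ ‖p.2‖ := min_le_max
      have hc := inner_le_max_mul_min p.1 p.2
      have h3 := Real.sqrt_eq_zero'.1 h.symm
      set M := max ‖p.1‖ ‖p.2‖
      set m := min ‖p.1‖ ‖p.2‖
      have h4 : 0 < M - η * m := by nlinarith
      nlinarith [mul_pos h4 h4]
    have hx : p.1 = 0 := norm_le_zero_iff.1 (hM ▸ le_max_left _ _)
    have hy : p.2 = 0 := norm_le_zero_iff.1 (hM ▸ le_max_right _ _)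
    simp [regKernel, energyKernel, hx, hy, Real.zero_rpow hs.ne']
  · rw [regKernel, energyKernel, ENNReal.ofReal_div_of_pos (by positivity)]

theorem energyKernel_regDist_le {s η : ℝ} (h1 : 1 / 2 ≤ η) (h2 : η ≤ 1) (p : E3 × E3) :
    energyKernel s (regDist η) p ≤ 2 * energyKernel s (regDist 1) p := by
  have h := norm_sub_le_two_mul_regDist h1 h2 p.1 p.2
  rw [norm_sub_eq_regDist] at h
  have h3 : ENNReal.ofReal (2 * regDist 1 p.1 p.2) ≤ 2 * ENNReal.ofReal (2 * regDist η p.1 p.2) := by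
    rw [← ENNReal.ofReal_ofNat 2, ← ENNReal.ofReal_mul (by norm_num)]
    exact ENNReal.ofReal_le_ofReal (by linarith)
  calc energyKernel s (regDist η) p
      = 2 * (ENNReal.ofReal (‖p.1‖ ^ s + ‖p.2‖ ^ s) /
          (2 * ENNReal.ofReal (2 * regDist η p.1 p.2))) := by
        rw [energyKernel, div_eq_mul_inv, div_eq_mul_inv, ENNReal.mul_inv (by simp) (by simp),
          mul_left_comm, ← mul_assoc 2, ENNReal.mul_inv_cancel (by simp) (by simp), one_mul]
    _ ≤ _ := by
        unfold energyKernel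
        gcongr

/-- From $|x-y|\le2\max(|x|,|y|)$; hence finite energy makes the degree 0 term integrable. -/
theorem ofReal_zonalKernel_zero_le (s : ℝ) (p : E3 × E3) :
    ENNReal.ofReal (zonalKernel s 0 p.1 p.2) ≤ 2 * energyKernel s (regDist 1) p := by
  rw [zonalKernel_zero]
  rcases (le_max_of_le_left (norm_nonneg p.1) : 0 ≤ max ‖p.1‖ ‖p.2‖).eq_or_lt with hM | hM
  · simp [← hM]
  · have h : regDist 1 p.1 p.2 ≤ 2 * max ‖p.1‖ ‖p.2‖ := by
      rw [← norm_sub_eq_regDist]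
      linarith [norm_sub_le p.1 p.2, le_max_left ‖p.1‖ ‖p.2‖, le_max_right ‖p.1‖ ‖p.2‖]
    have e : (‖p.1‖ ^ s + ‖p.2‖ ^ s) / 2 / max ‖p.1‖ ‖p.2‖ =
        2 * ((‖p.1‖ ^ s + ‖p.2‖ ^ s) / (2 * (2 * max ‖p.1‖ ‖p.2‖))) := by
      field_simp
    rw [e, ENNReal.ofReal_mul (by norm_num), ENNReal.ofReal_ofNat,
      ENNReal.ofReal_div_of_pos (by positivity), energyKernel]
    gcongr

theorem tendsto_energyKernel_regDist {s : ℝ} (hs : 0 < s) {u : ℕ → ℝ}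
    (hu : Tendsto u atTop (𝓝 1)) (p : E3 × E3) :
    Tendsto (fun n => energyKernel s (regDist (u n)) p) atTop
      (𝓝 (energyKernel s (regDist 1) p)) := by
  by_cases h : p.1 = 0 ∧ p.2 = 0
  · simp [energyKernel, h.1, h.2, Real.zero_rpow hs.ne']
  -- Away from the origin the numerator is nonzero, so the quotient in $[0,\infty]$ is continuous
  -- even where the distance tends to 0.
  · refine ENNReal.Tendsto.div tendsto_const_nhds (Or.inl ?_) ?_ (Or.inl ENNReal.ofReal_ne_top)
    · rw [ne_eq, ENNReal.ofReal_eq_zero, not_le]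
      rw [not_and_or] at h
      rcases h with h | h
      · have := Real.rpow_pos_of_pos (norm_pos_iff.2 h) s
        positivity
      · have := Real.rpow_pos_of_pos (norm_pos_iff.2 h) s
        positivity
    · refine ENNReal.tendsto_ofReal (Tendsto.const_mul 2 ?_)
      exact ((continuous_regDist_left p.1 p.2).tendsto 1).comp hu

/-- Passing to the radial part does not increase the energy. -/
theorem weightedEnergy_radialPart_le {s : ℝ} (hs : 1 ≤ s) (hs₃ : s ≤ 3)
    (ρ : ProbabilityMeasure E3) : weightedEnergy s (radialPart ρ) ≤ weightedEnergy s ρ := by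
  by_cases htop : weightedEnergy s ρ = ∞
  · rw [htop]; exact le_top
  have hs0 : 0 < s := by linarith
  rw [weightedEnergy_eq] at htop
  rw [weightedEnergy_eq, weightedEnergy_eq]
  have hint : Integrable (fun p => zonalKernel s 0 p.1 p.2)
      ((ρ : Measure E3).prod (ρ : Measure E3)) := by
    refine ⟨(measurable_zonalKernel s 0).aestronglyMeasurable, ?_⟩
    rw [hasFiniteIntegral_iff_ofReal (Eventually.of_forall fun p => zonalKernel_zero_nonneg s _ _)]
    refine (lintegral_mono fun p => ofReal_zonalKernel_zero_le s p).trans_lt ?_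
    rw [lintegral_const_mul _ (measurable_energyKernel_regDist s 1)]
    exact ENNReal.mul_lt_top (by simp) (lt_top_iff_ne_top.2 htop)
  have hint' := (integral_zonalKernel_radialPart_le hs hs₃ hint).1
  set u : ℕ → ℝ := fun n => 1 - 1 / 2 * (1 / ((n : ℝ) + 1)) with hu
  have hu1 : Tendsto u atTop (𝓝 1) := by
    have := (tendsto_one_div_add_atTop_nhds_zero_nat (𝕜 := ℝ)).const_mul (1 / 2) |>.const_sub 1
    simpa [hu] using this
  have hub (n : ℕ) : 1 / 2 ≤ u n ∧ u n < 1 := by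
    have h1 : 0 < 1 / ((n : ℝ) + 1) := by positivity
    have h2 : 1 / ((n : ℝ) + 1) ≤ 1 := by
      rw [div_le_one (by positivity)]
      linarith [n.cast_nonneg (α := ℝ)]
    constructor <;> simp only [hu] <;> linarith
  -- Finite energy of `ρ` permits dominated convergence on this side.
  have hlim : Tendsto (fun n => ∫⁻ p, energyKernel s (regDist (u n)) p
      ∂((ρ : Measure E3).prod (ρ : Measure E3))) atTop
      (𝓝 (∫⁻ p, energyKernel s (regDist 1) p ∂((ρ : Measure E3).prod (ρ : Measure E3)))) := by
    refine tendsto_lintegral_of_dominated_convergence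
      (fun p => 2 * energyKernel s (regDist 1) p)
      (fun n => measurable_energyKernel_regDist s (u n))
      (fun n => Eventually.of_forall fun p => energyKernel_regDist_le (hub n).1 (hub n).2.le p)
      ?_ (Eventually.of_forall fun p => tendsto_energyKernel_regDist hs0 hu1 p)
    rw [lintegral_const_mul _ (measurable_energyKernel_regDist s 1)]
    exact ENNReal.mul_ne_top (by simp) htop
  have hle (n : ℕ) : ∫⁻ p, energyKernel s (regDist (u n)) p
        ∂((radialPart ρ : Measure E3).prod (radialPart ρ : Measure E3)) ≤
      ∫⁻ p, energyKernel s (regDist (u n)) p ∂((ρ : Measure E3).prod (ρ : Measure E3)) := by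
    have hn0 : 0 ≤ u n := by linarith [(hub n).1]
    simp only [← ofReal_regKernel hs0 (hub n).1 (hub n).2]
    rw [← ofReal_integral_eq_lintegral_ofReal (integrable_regKernel hn0 (hub n).2 hint')
        (Eventually.of_forall fun p => regKernel_nonneg s _ _ _),
      ← ofReal_integral_eq_lintegral_ofReal (integrable_regKernel hn0 (hub n).2 hint)
        (Eventually.of_forall fun p => regKernel_nonneg s _ _ _)]
    exact ENNReal.ofReal_le_ofReal (integral_regKernel_radialPart_le hs hs₃ hn0 (hub n).2 hint)
  -- Finiteness of the energy of the radial part is not yet known, so Fatou's lemma is used there.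
  calc ∫⁻ p, energyKernel s (regDist 1) p
        ∂((radialPart ρ : Measure E3).prod (radialPart ρ : Measure E3))
      = ∫⁻ p, liminf (fun n => energyKernel s (regDist (u n)) p) atTop
        ∂((radialPart ρ : Measure E3).prod (radialPart ρ : Measure E3)) :=
        lintegral_congr fun p => (tendsto_energyKernel_regDist hs0 hu1 p).liminf_eq.symm
    _ ≤ liminf (fun n => ∫⁻ p, energyKernel s (regDist (u n)) p
        ∂((radialPart ρ : Measure E3).prod (radialPart ρ : Measure E3))) atTop :=
        lintegral_liminf_le fun n => measurable_energyKernel_regDist s (u n)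
    _ ≤ liminf (fun n => ∫⁻ p, energyKernel s (regDist (u n)) p
        ∂((ρ : Measure E3).prod (ρ : Measure E3))) atTop :=
        liminf_le_liminf (Eventually.of_forall hle)
    _ = _ := hlim.liminf_eq

end Regularization

/-! ### The radial part stays in $H^{-1}$, by duality with $L^2$. -/

section Sobolev

open SchwartzMap TemperedDistribution FourierTransform
open scoped SchwartzMap

variable {E : Type*} [NormedAddCommGroup E] [InnerProductSpace ℝ E]

/-- Composition of a Schwartz function with a linear isometry. -/
def schwartzComp (A : E ≃ₗᵢ[ℝ] E) (u : 𝓢(E, ℂ)) : 𝓢(E, ℂ) :=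
  compCLMOfContinuousLinearEquiv ℂ A.toContinuousLinearEquiv u

theorem schwartzComp_apply (A : E ≃ₗᵢ[ℝ] E) (u : 𝓢(E, ℂ)) (x : E) :
    schwartzComp A u x = u (A x) := rfl

variable [FiniteDimensional ℝ E] [MeasurableSpace E] [BorelSpace E]

theorem exists_norm_toTemperedDistribution_apply_le (f : Lp ℂ 2 (volume : Measure E)) :
    ∃ C, ∀ u : 𝓢(E, ℂ), ‖(f : 𝓢'(E, ℂ)) u‖ ≤ C * ‖u.toLp 2‖ := by
  refine ⟨‖star f‖, fun u => ?_⟩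
  have h : (f : 𝓢'(E, ℂ)) u = inner ℂ (star f) (u.toLp 2) := by
    rw [Lp.toTemperedDistribution_apply, L2.inner_def]
    refine integral_congr_ae ?_
    filter_upwards [Lp.coeFn_star f, u.coeFn_toLp 2] with x h1 h2
    rw [h1, h2]
    simp
  rw [h]
  exact norm_inner_le_norm _ _

/-- A tempered distribution that is bounded for the `L²` norm is given by an `L²` function. -/
theorem exists_eq_toTemperedDistribution_of_norm_apply_le {T : 𝓢'(E, ℂ)} {C : ℝ}
    (hT : ∀ u : 𝓢(E, ℂ), ‖T u‖ ≤ C * ‖u.toLp 2‖) :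
    ∃ f : Lp ℂ 2 (volume : Measure E), T = f := by
  let e : 𝓢(E, ℂ) →ₗ[ℂ] Lp ℂ 2 (volume : Measure E) := (toLpCLM ℂ ℂ 2 volume).toLinearMap
  let t : 𝓢(E, ℂ) →ₗ[ℂ] ℂ :=
    { toFun := fun u => T u, map_add' := map_add T, map_smul' := map_smul T }
  have hd : DenseRange e := denseRange_toLpCLM (F := ℂ) (p := 2) ENNReal.ofNat_ne_top
  let ℓ : Lp ℂ 2 (volume : Measure E) →L[ℂ] ℂ := t.extendOfNorm e
  have hℓ (u : 𝓢(E, ℂ)) : ℓ (u.toLp 2) = T u := t.extendOfNorm_eq hd ⟨C, hT⟩ u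
  let g := (InnerProductSpace.toDual ℂ (Lp ℂ 2 (volume : Measure E))).symm ℓ
  refine ⟨star g, ?_⟩
  ext u
  rw [← hℓ, ← InnerProductSpace.toDual_symm_apply, Lp.toTemperedDistribution_apply, L2.inner_def]
  refine integral_congr_ae ?_
  filter_upwards [Lp.coeFn_star g, u.coeFn_toLp 2] with x h1 h2
  rw [h1, h2]
  simp [g]

theorem norm_toLp_schwartzComp (A : E ≃ₗᵢ[ℝ] E) (u : 𝓢(E, ℂ)) :
    ‖(schwartzComp A u).toLp 2‖ = ‖u.toLp 2‖ := by
  rw [norm_toLp, norm_toLp]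
  congr 1
  exact eLpNorm_comp_measurePreserving u.continuous.aestronglyMeasurable A.measurePreserving

/-- The Bessel potential on Schwartz functions, as it appears in the definition by duality of the
Bessel potential of a tempered distribution. -/
def schwartzBessel (s : ℝ) (u : 𝓢(E, ℂ)) : 𝓢(E, ℂ) :=
  𝓕 (SchwartzMap.smulLeftCLM ℂ (fun x : E => (((1 + ‖x‖ ^ 2) ^ (s / 2) : ℝ) : ℂ)) (𝓕⁻ u))

theorem besselPotential_apply (s : ℝ) (T : 𝓢'(E, ℂ)) (u : 𝓢(E, ℂ)) :
    besselPotential E ℂ s T u = T (schwartzBessel s u) := rfl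

/-- The Fourier transform commutes with linear isometries, and the Bessel multiplier depends only on
the norm. -/
theorem schwartzBessel_schwartzComp (s : ℝ) (A : E ≃ₗᵢ[ℝ] E) (u : 𝓢(E, ℂ)) :
    schwartzBessel s (schwartzComp A u) = schwartzComp A (schwartzBessel s u) := by
  have h1 : 𝓕⁻ (schwartzComp A u) = schwartzComp A (𝓕⁻ u) := by
    ext x
    rw [schwartzComp_apply, fourierInv_coe, fourierInv_coe]
    exact Real.fourierInv_comp_linearIsometry A u x
  have hg : (fun x : E => (((1 + ‖x‖ ^ 2) ^ (s / 2) : ℝ) : ℂ)).HasTemperateGrowth := by fun_prop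
  have h2 (v : 𝓢(E, ℂ)) :
      SchwartzMap.smulLeftCLM ℂ (fun x : E => (((1 + ‖x‖ ^ 2) ^ (s / 2) : ℝ) : ℂ))
        (schwartzComp A v) = schwartzComp A (SchwartzMap.smulLeftCLM ℂ
          (fun x : E => (((1 + ‖x‖ ^ 2) ^ (s / 2) : ℝ) : ℂ)) v) := by
    ext x
    rw [schwartzComp_apply, SchwartzMap.smulLeftCLM_apply_apply hg,
      SchwartzMap.smulLeftCLM_apply_apply hg, schwartzComp_apply, A.norm_map]
  ext x
  rw [schwartzBessel, h1, h2, schwartzComp_apply, schwartzBessel, fourier_coe, fourier_coe]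
  exact Real.fourier_comp_linearIsometry A _ x

/-- The radial part of a measure in `H⁻¹` is in `H⁻¹`. -/
theorem memHNegOne_radialPart {ρ : ProbabilityMeasure E3} (h : MemHNegOne ρ) :
    MemHNegOne (radialPart ρ) := by
  obtain ⟨f, hf⟩ := h
  obtain ⟨C, hC⟩ := exists_norm_toTemperedDistribution_apply_le f
  rw [← hf] at hC
  refine exists_eq_toTemperedDistribution_of_norm_apply_le (C := C) fun u => ?_
  change ‖∫ x, schwartzBessel (-1) u x ∂(radialPart ρ : Measure E3)‖ ≤ _
  set b := schwartzBessel (-1) u with hb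
  -- Rotating the test function preserves its $L^2$ norm, so one constant `C` serves every `U` and
  -- survives averaging over the group.
  have hU (U : SO3) : ‖∫ x, b (SO3.rotate U⁻¹ x) ∂(ρ : Measure E3)‖ ≤ C * ‖u.toLp 2‖ := by
    have := hC (schwartzComp U⁻¹.rotateIsometry u)
    rw [besselPotential_apply, schwartzBessel_schwartzComp, norm_toLp_schwartzComp] at this
    exact this
  have e : ∫ x, b x ∂(radialPart ρ : Measure E3) =
      ∫ U, ∫ x, b (SO3.rotate U⁻¹ x) ∂(ρ : Measure E3) ∂SO3.haar := by
    change ∫ x, b x ∂((SO3.haar.prod (ρ : Measure E3)).map SO3.rotateInv) = _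
    rw [integral_map SO3.measurable_rotateInv.aemeasurable b.continuous.aestronglyMeasurable,
      integral_prod]
    · rfl
    · refine (integrable_const ‖b.toBoundedContinuousFunction‖).mono'
        (b.continuous.comp SO3.continuous_rotateInv).aestronglyMeasurable
        (Filter.Eventually.of_forall fun p => ?_)
      exact b.toBoundedContinuousFunction.norm_coe_le_norm _
  rw [e]
  simpa using norm_integral_le_of_norm_le_const (μ := SO3.haar) (Filter.Eventually.of_forall hU)

end Sobolev

/-! ### Conclusion. -/

theorem radialPart_mem_admissible {s : ℝ} {μ : ProbabilityMeasure E3} (h : μ ∈ admissible s) :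
    radialPart μ ∈ admissible s :=
  ⟨memHNegOne_radialPart h.1, by rw [absMoment_radialPart]; exact h.2⟩

theorem theorem4 (s : ℝ) (hs₁ : 1 ≤ s) (hs₃ : s ≤ 3) :
    beta s = betaRad s ∧
      ∀ ρ : ProbabilityMeasure E3, MemHNegOne ρ → weightedEnergy s (radialPart ρ) ≤ weightedEnergy s ρ := by
  refine ⟨le_antisymm (biInf_mono fun μ hμ => hμ.1) ?_,
    fun ρ _ => weightedEnergy_radialPart_le hs₁ hs₃ ρ⟩
  refine le_iInf₂ fun μ hμ => ?_
  -- The radial part of `μ` competes in the radial problem with the same denominator and no larger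
  -- numerator.
  refine (iInf₂_le (radialPart μ) ⟨radialPart_mem_admissible hμ, isRadial_radialPart μ⟩).trans ?_
  rw [absMoment_radialPart]
  gcongr
  exact weightedEnergy_radialPart_le hs₁ hs₃ μ

end
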